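/- Let $p$ be a prime with $p\equiv 1 \pmod{10}$. Then $\mathbb{Z}_p^*$ contains elements of multiplicative order $5$. Let $\xi$ be any such element, and let $A$ and $B$ be the elements of $\mathrm{PSL}(2,p)=\mathrm{SL}(2,p)/\{I,-I\}$ represented by $$\begin{pmatrix} 0 & 1\\ -1 & 0\end{pmatrix}\quad\text{and}\quad \begin{pmatrix} \xi & \xi+\xi^{-1}\\ 0 & \xi^{-1}\end{pmatrix},$$ respectively. Let $H=\langle A\rangle$ and let $\Gamma=\mathrm{Cos}(\mathrm{PSL}(2,p),H,\{B,B^{-1}\})$ be the double coset graph, that is, the graph whose vertices are the right cosets $Hg$ of $H$ in $\mathrm{PSL}(2,p)$, with $Hg$ and $Hg'$ adjacent if and only if $g'g^{-1}\in H\{B,B^{-1}\}H$. Then $\Gamma$ is a connected tetravalent graph of girth $5$ and order $p(p^2-1)/4$, and it is arc-transitive (its full automorphism group is transitive on the ordered pairs of adjacent vertices). The action of $\mathrm{PSL}(2,p)$ on $\Gamma$ by right multiplication is faithful, and it is half-arc-transitive, that is, transitive on the vertices and on the edges of $\Gamma$ but not on the ordered pairs of adjacent vertices. Moreover, each edge of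 $\Gamma$ lies on exactly two $5$-cycles of $\Gamma$. -/

import Mathlib

open scoped Pointwise

/-! ### Groups of automorphisms of a graph -/

/-- A group `K` of automorphisms is transitive on the vertices of `Γ`. -/
def GraphVertexTransitive {V : Type*} {Γ : SimpleGraph V} (K : Subgroup (Γ ≃g Γ)) : Prop :=
  ∀ u v : V, ∃ k ∈ K, k u = v

/-- A group `K` of automorphisms is transitive on the (undirected) edges of `Γ`. -/
def GraphEdgeTransitive {V : Type*} {Γ : SimpleGraph V} (K : Subgroup (Γ ≃g Γ)) : Prop :=
  ∀ e ∈ Γ.edgeSet, ∀ f ∈ Γ.edgeSet, ∃ k ∈ K, Sym2.map k e = f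

/-- A group `K` of automorphisms is transitive on the arcs (ordered pairs of adjacent vertices)
of `Γ`. -/
def GraphArcTransitive {V : Type*} {Γ : SimpleGraph V} (K : Subgroup (Γ ≃g Γ)) : Prop :=
  ∀ u v u' v' : V, Γ.Adj u v → Γ.Adj u' v' → ∃ k ∈ K, k u = u' ∧ k v = v'

/-- A group `K` of automorphisms is half-arc-transitive on `Γ`: it is transitive on vertices and
on edges, but not on arcs. -/
def GraphHalfArcTransitive {V : Type*} {Γ : SimpleGraph V} (K : Subgroup (Γ ≃g Γ)) : Prop :=
  GraphVertexTransitive K ∧ GraphEdgeTransitive K ∧ ¬ GraphArcTransitive K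

/-- The set of cycles of length `n` of `Γ` through the edge `e`. Cycles are taken as subgraphs, so
that the choice of a starting point and of a direction does not matter. -/
def cyclesThrough {V : Type*} (Γ : SimpleGraph V) (n : ℕ) (e : Sym2 V) : Set Γ.Subgraph :=
  {C | e ∈ C.edgeSet ∧ ∃ (v : V) (c : Γ.Walk v v), c.IsCycle ∧ c.length = n ∧ c.toSubgraph = C}

/-! ### Double coset graphs -/

/-- The set of right cosets `H g` of `H` in `G`. -/
abbrev RightCosets {G : Type*} [Group G] (H : Subgroup G) : Type _ :=
  Quotient (QuotientGroup.rightRel H)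

/-- The right coset `H g`. -/
abbrev rightCoset {G : Type*} [Group G] (H : Subgroup G) (g : G) : RightCosets H :=
  Quotient.mk (QuotientGroup.rightRel H) g

/-- The double coset graph `Cos(G, H, S)` for an inverse-closed set `S`: its vertices are the right
cosets of `H`, and the distinct vertices `H g` and `H g'` are adjacent if and only if
`g' g⁻¹ ∈ H S H`. (The condition of distinctness excludes loops; it is automatic when `S` is
disjoint from `H`.) -/
def cosGraph {G : Type*} [Group G] (H : Subgroup G) (S : Set G) (hS : S⁻¹ = S) :
    SimpleGraph (RightCosets H) where
  Adj u v := u ≠ v ∧ ∃ g g' : G, u = rightCoset H g ∧ v = rightCoset H g' ∧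
    g' * g⁻¹ ∈ (H : Set G) * S * (H : Set G)
  symm := ⟨by
    rintro u v ⟨huv, g, g', hu, hv, h⟩
    refine ⟨huv.symm, g', g, hv, hu, ?_⟩
    have h2 := Set.inv_mem_inv.mpr h
    rw [mul_inv_rev, mul_inv_rev, hS, inv_coe_set, ← mul_assoc] at h2
    simpa using h2⟩
  loopless := ⟨fun u h => h.1 rfl⟩

/-- The description of adjacency does not depend on the chosen representatives. -/
theorem cosGraph_adj {G : Type*} [Group G] (H : Subgroup G) (S : Set G) (hS : S⁻¹ = S)
    (g g' : G) : (cosGraph H S hS).Adj (rightCoset H g) (rightCoset H g') ↔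
      rightCoset H g ≠ rightCoset H g' ∧ g' * g⁻¹ ∈ (H : Set G) * S * (H : Set G) := by
  constructor
  · rintro ⟨hne, x, x', hx, hx', h⟩
    refine ⟨hne, ?_⟩
    have h1 : x * g⁻¹ ∈ H := QuotientGroup.rightRel_apply.mp (Quotient.exact hx)
    have h2 : x' * g'⁻¹ ∈ H := QuotientGroup.rightRel_apply.mp (Quotient.exact hx')
    obtain ⟨y, ⟨a, ha, s, hs, rfl⟩, b, hb, hy⟩ := h
    refine ⟨(x' * g'⁻¹)⁻¹ * a * s, ⟨(x' * g'⁻¹)⁻¹ * a, H.mul_mem (H.inv_mem h2) ha, s, hs, rfl⟩,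
      b * (x * g⁻¹), H.mul_mem hb h1, ?_⟩
    simp only at hy ⊢
    have hb' : b = (a * s)⁻¹ * (x' * x⁻¹) := by rw [← hy]; group
    rw [hb']; group
  · rintro ⟨hne, h⟩
    exact ⟨hne, g, g', rfl, rfl, h⟩

/-- Right multiplication by `a` as a permutation of the right cosets: `H g ↦ H g a`. -/
def rightMulCoset {G : Type*} [Group G] (H : Subgroup G) (a : G) : RightCosets H ≃ RightCosets H where
  toFun := Quotient.map (fun g => g * a) (fun g g' h => by
    have h' : g' * g⁻¹ ∈ H := QuotientGroup.rightRel_apply.mp h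
    exact QuotientGroup.rightRel_apply.mpr (by simpa [mul_assoc] using h'))
  invFun := Quotient.map (fun g => g * a⁻¹) (fun g g' h => by
    have h' : g' * g⁻¹ ∈ H := QuotientGroup.rightRel_apply.mp h
    exact QuotientGroup.rightRel_apply.mpr (by simpa [mul_assoc] using h'))
  left_inv := by
    rintro ⟨g⟩
    exact congrArg (rightCoset H) (mul_inv_cancel_right g a)
  right_inv := by
    rintro ⟨g⟩
    exact congrArg (rightCoset H) (inv_mul_cancel_right g a)

theorem rightMulCoset_mk {G : Type*} [Group G] (H : Subgroup G) (a g : G) :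
    rightMulCoset H a (rightCoset H g) = rightCoset H (g * a) := rfl

/-- Right multiplication by `a` as an automorphism of the double coset graph. -/
def cosRightMul {G : Type*} [Group G] (H : Subgroup G) (S : Set G) (hS : S⁻¹ = S) (a : G) :
    cosGraph H S hS ≃g cosGraph H S hS where
  toEquiv := rightMulCoset H a
  map_rel_iff' := by
    rintro ⟨g⟩ ⟨g'⟩
    change (cosGraph H S hS).Adj (rightMulCoset H a (rightCoset H g))
      (rightMulCoset H a (rightCoset H g')) ↔
      (cosGraph H S hS).Adj (rightCoset H g) (rightCoset H g')
    rw [cosGraph_adj, ← (rightMulCoset H a).injective.ne_iff, rightMulCoset_mk, rightMulCoset_mk,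
      cosGraph_adj]
    simp [mul_assoc]

/-- The action of `G` on `Cos(G, H, S)` by right multiplication, as a homomorphism into the group of
automorphisms. Automorphisms are composed from right to left, so `a` is sent to `H g ↦ H g a⁻¹`. -/
def cosAction {G : Type*} [Group G] (H : Subgroup G) (S : Set G) (hS : S⁻¹ = S) :
    G →* (cosGraph H S hS ≃g cosGraph H S hS) where
  toFun a := cosRightMul H S hS a⁻¹
  map_one' := by
    apply RelIso.ext
    rintro ⟨g⟩
    exact congrArg (rightCoset H) (by simp)
  map_mul' a b := by
    apply RelIso.ext
    rintro ⟨g⟩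
    exact congrArg (rightCoset H) (by simp [mul_assoc])

/-! ### The graphs arising from `PSL(2, p)` -/

/-- `PSL(2, p)`, the quotient of `SL(2, p)` by its centre (which is `{I, -I}` for `p` prime). -/
abbrev PSL2 (p : ℕ) [Fact p.Prime] : Type :=
  Matrix.ProjectiveSpecialLinearGroup (Fin 2) (ZMod p)

/-- The class in `PSL(2, p)` of a matrix from `SL(2, p)`. -/
def toPSL2 (p : ℕ) [Fact p.Prime] (M : Matrix.SpecialLinearGroup (Fin 2) (ZMod p)) : PSL2 p :=
  QuotientGroup.mk M

/-- The element `A` of `PSL(2, p)`. -/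
def pslA (p : ℕ) [Fact p.Prime] : PSL2 p :=
  toPSL2 p ⟨!![0, 1; -1, 0], by simp [Matrix.det_fin_two]⟩

/-- The element `B` of `PSL(2, p)` determined by `ξ`. -/
def pslB (p : ℕ) [Fact p.Prime] (ξ : (ZMod p)ˣ) : PSL2 p :=
  toPSL2 p ⟨!![(ξ : ZMod p), (ξ : ZMod p) + ((ξ⁻¹ : (ZMod p)ˣ) : ZMod p);
    0, ((ξ⁻¹ : (ZMod p)ˣ) : ZMod p)], by
      rw [Matrix.det_fin_two_of, mul_zero, sub_zero, Units.mul_inv]⟩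

theorem pair_inv_eq {G : Type*} [Group G] (b : G) : ({b, b⁻¹} : Set G)⁻¹ = {b, b⁻¹} := by
  ext x
  simp only [Set.mem_inv, Set.mem_insert_iff, Set.mem_singleton_iff, inv_eq_iff_eq_inv, inv_inv]
  exact or_comm

/-- The graph `Cos(PSL(2, p), ⟨A⟩, {B, B⁻¹})`. -/
def pslGraph (p : ℕ) [Fact p.Prime] (ξ : (ZMod p)ˣ) :
    SimpleGraph (RightCosets (Subgroup.zpowers (pslA p))) :=
  cosGraph (Subgroup.zpowers (pslA p)) {pslB p ξ, (pslB p ξ)⁻¹} (pair_inv_eq (pslB p ξ))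

/-- The action of `PSL(2, p)` on its double coset graph by right multiplication. -/
def pslAction (p : ℕ) [Fact p.Prime] (ξ : (ZMod p)ˣ) :
    PSL2 p →* (pslGraph p ξ ≃g pslGraph p ξ) :=
  cosAction (Subgroup.zpowers (pslA p)) {pslB p ξ, (pslB p ξ)⁻¹} (pair_inv_eq (pslB p ξ))

/-! ### Pentagons in a graph. -/

namespace SimpleGraph

variable {V : Type*} {Γ : SimpleGraph V}

/-! Put H = ⟨A⟩, of order two. The neighbours of Hg are the cosets Hsg with s among B, BA, B⁻¹,
B⁻¹A, so walks from H are words in these steps. A walk closes when its word lies in H, and going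
back along an edge is the cancellation of B against B⁻¹. The relations B⁵ = 1 and (BA)⁵ = 1 give two
pentagons on the arc (H, HB). Valency, girth and the count of pentagons follow once no nonempty
reduced word of length at most 4 lies in H, and no word of length 5 starting along HB does except
along these two pentagons. `PentagonPair` isolates what is needed of the group.

Right multiplication carries every arc to (H, HB) or to its reverse. Reversing (H, HB) by right
multiplication would put some B Aᵈ B in H, so the group is only half-arc-transitive. A group
automorphism fixing A and inverting B, followed by right multiplication by B, does reverse this arc.
Hence the graph is arc-transitive and local statements need checking on one arc only.

The word conditions are verified for all p at once. Words are evaluated as matrices over ℤ[ζ], with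
ζ a primitive fifth root of unity. If a word lies in H modulo p, certain entries vanish at ξ, so p
divides the norms of these entries. A finite computation shows that the gcd of such norms divides a
power of 30, while p ≡ 1 mod 10 is prime to 30 (`CycInt.not_eval_eq_zero`).

Connectedness requires A and B to generate. If p divides the order of the group they generate in
SL(2, p), that group contains a transvection and, having no invariant line, is everything
(`eq_top_of_dvd_card`). Otherwise each of its nonscalar elements has exactly two fixed points on the
projective line over the field with p² elements. Klein's orbit count
(`fixedPoint_or_orbit_two_or_pow_eq_one`) leaves a common fixed point, an orbit of length two, or
only elements of order at most 5, and each case is refuted. -/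

/-- The closed walk of length five along the pentagon `u v a b d`. -/
def pentagonWalk {u v a b d : V} (h₁ : Γ.Adj u v) (h₂ : Γ.Adj v a) (h₃ : Γ.Adj a b)
    (h₄ : Γ.Adj b d) (h₅ : Γ.Adj d u) : Γ.Walk u u :=
  .cons h₁ (.cons h₂ (.cons h₃ (.cons h₄ (.cons h₅ .nil))))

theorem pentagonWalk_isCycle {u v a b d : V} (h₁ : Γ.Adj u v) (h₂ : Γ.Adj v a)
    (h₃ : Γ.Adj a b) (h₄ : Γ.Adj b d) (h₅ : Γ.Adj d u) (hn : [u, v, a, b, d].Nodup) :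
    (pentagonWalk h₁ h₂ h₃ h₄ h₅).IsCycle := by
  rw [pentagonWalk, Walk.cons_isCycle_iff]
  simp only [List.nodup_cons, List.mem_cons, List.not_mem_nil, or_false, not_or] at hn
  simp only [Walk.isPath_def, Walk.support_cons, Walk.support_nil, Walk.edges_cons,
    Walk.edges_nil, List.nodup_cons, List.mem_cons, List.not_mem_nil, or_false, not_or, Sym2.eq_iff]
  grind

theorem Walk.IsCycle.eq_pentagonWalk {u : V} {c : Γ.Walk u u} (hc : c.IsCycle)
    (hl : c.length = 5) :
    ∃ (v a b d : V) (h₁ : Γ.Adj u v) (h₂ : Γ.Adj v a) (h₃ : Γ.Adj a b) (h₄ : Γ.Adj b d)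
      (h₅ : Γ.Adj d u), [u, v, a, b, d].Nodup ∧ c = pentagonWalk h₁ h₂ h₃ h₄ h₅ := by
  match c, hl with
  | .cons h₁ (.cons h₂ (.cons h₃ (.cons h₄ (.cons h₅ .nil)))), _ =>
    refine ⟨_, _, _, _, h₁, h₂, h₃, h₄, h₅, ?_, rfl⟩
    have := hc.support_nodup
    simp only [Walk.support_cons, Walk.support_nil, List.tail_cons, List.nodup_cons,
      List.mem_cons, List.not_mem_nil, or_false, not_or] at this ⊢
    grind

theorem girth_eq_five (h3 : ∀ u v w, Γ.Adj u v → Γ.Adj v w → ¬ Γ.Adj w u)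
    (h4 : ∀ u v a b, Γ.Adj u v → Γ.Adj v a → Γ.Adj a b → Γ.Adj b u → a ≠ u → b = v)
    {u v a b d : V} (h₁ : Γ.Adj u v) (h₂ : Γ.Adj v a)
    (h₃ : Γ.Adj a b) (h₄ : Γ.Adj b d) (h₅ : Γ.Adj d u) (hn : [u, v, a, b, d].Nodup) :
    Γ.girth = 5 := by
  have hcyc := pentagonWalk_isCycle h₁ h₂ h₃ h₄ h₅ hn
  refine le_antisymm (show Γ.girth ≤ 5 from girth_le_length hcyc) ?_
  -- An acyclic graph has girth 0 by convention, so the lower bound needs the pentagon too.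
  obtain ⟨w, c, hc, hl⟩ := exists_girth_eq_length.mpr (fun h => h _ hcyc)
  rw [hl]
  by_contra! hlt
  have h3' := hc.three_le_length
  have hcase : c.length = 3 ∨ c.length = 4 := by omega
  rcases hcase with hk | hk
  · match c, hk with
    | .cons h₁ (.cons h₂ (.cons h₃ .nil)), _ => exact h3 _ _ _ h₁ h₂ h₃
  · match c, hk with
    | .cons h₁ (.cons h₂ (.cons h₃ (.cons h₄ .nil))), _ =>
      have := hc.support_nodup
      simp only [Walk.support_cons, Walk.support_nil, List.tail_cons, List.nodup_cons,
        List.mem_cons, List.not_mem_nil, or_false, not_or] at this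
      have h := h4 _ _ _ _ h₁ h₂ h₃ h₄ (by grind)
      grind

/-- A cycle of length five through the edge `uv` is the pentagon `u v a b d` for some `a b d`. -/
theorem exists_pentagonWalk_of_mem_cyclesThrough {u v : V} {C : Γ.Subgraph}
    (hC : C ∈ cyclesThrough Γ 5 s(u, v)) :
    ∃ (a b d : V) (h₁ : Γ.Adj u v) (h₂ : Γ.Adj v a) (h₃ : Γ.Adj a b) (h₄ : Γ.Adj b d)
      (h₅ : Γ.Adj d u), [u, v, a, b, d].Nodup ∧
      C = (pentagonWalk h₁ h₂ h₃ h₄ h₅).toSubgraph := by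
  classical
  obtain ⟨he, w, c, hc, hl, rfl⟩ := hC
  rw [Walk.mem_edges_toSubgraph] at he
  have hu : u ∈ c.support := Walk.fst_mem_support_of_mem_edges c he
  rw [← (c.rotate_edges u hu).mem_iff] at he
  rw [← Walk.toSubgraph_rotate c hu]
  have hl' : (c.rotate u hu).length = 5 := by
    rw [← Walk.length_edges, (c.rotate_edges u hu).perm.length_eq, Walk.length_edges, hl]
  obtain ⟨v', a, b, d, h₁, h₂, h₃, h₄, h₅, hn, heq⟩ :=
    (hc.rotate hu).eq_pentagonWalk hl'
  rw [heq] at he ⊢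
  -- In the cycle rotated to start at u, the edge uv comes first or last; in the latter case the
  -- cycle is reversed.
  have hv : v = v' ∨ v = d := by
    simp only [pentagonWalk, Walk.edges_cons, Walk.edges_nil, List.mem_cons, Sym2.eq_iff,
      List.not_mem_nil, or_false, List.nodup_cons, not_or] at he hn
    grind
  rcases hv with rfl | rfl
  · exact ⟨a, b, d, h₁, h₂, h₃, h₄, h₅, hn, rfl⟩
  · refine ⟨b, a, v', h₅.symm, h₄.symm, h₃.symm, h₂.symm, h₁.symm, ?_, ?_⟩
    · simp only [List.nodup_cons, List.mem_cons, List.not_mem_nil, or_false, not_or] at hn ⊢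
      grind
    · rw [← Walk.toSubgraph_reverse]
      rfl

/-- If exactly two pentagons start with the arc `uv`, then the edge `uv` lies on exactly two cycles
of length five. -/
theorem ncard_cyclesThrough_five {u v a b d a' b' d' : V}
    (h₁ : Γ.Adj u v) (h₂ : Γ.Adj v a) (h₃ : Γ.Adj a b) (h₄ : Γ.Adj b d) (h₅ : Γ.Adj d u)
    (hn : [u, v, a, b, d].Nodup)
    (h₂' : Γ.Adj v a') (h₃' : Γ.Adj a' b') (h₄' : Γ.Adj b' d') (h₅' : Γ.Adj d' u)
    (hn' : [u, v, a', b', d'].Nodup) (hne : a ≠ a')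
    (huniq : ∀ x y z, Γ.Adj v x → Γ.Adj x y → Γ.Adj y z → Γ.Adj z u → [u, v, x, y, z].Nodup →
      (x = a ∧ y = b ∧ z = d) ∨ (x = a' ∧ y = b' ∧ z = d')) :
    (cyclesThrough Γ 5 s(u, v)).ncard = 2 := by
  rw [Set.ncard_eq_two]
  refine ⟨(pentagonWalk h₁ h₂ h₃ h₄ h₅).toSubgraph, (pentagonWalk h₁ h₂' h₃' h₄' h₅').toSubgraph,
    ?_, ?_⟩
  -- The edge from v to a' separates the two: in the first pentagon v is joined only to u and a.
  · intro h
    have h1 : s(v, a') ∈ (pentagonWalk h₁ h₂' h₃' h₄' h₅').toSubgraph.edgeSet := by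
      rw [Walk.mem_edges_toSubgraph]; simp [pentagonWalk]
    rw [← h, Walk.mem_edges_toSubgraph] at h1
    simp only [pentagonWalk, Walk.edges_cons, Walk.edges_nil, List.mem_cons, Sym2.eq_iff,
      List.not_mem_nil, or_false, List.nodup_cons, not_or] at h1 hn hn'
    grind
  · ext C
    simp only [Set.mem_insert_iff, Set.mem_singleton_iff]
    constructor
    · intro hC
      obtain ⟨x, y, z, k₁, k₂, k₃, k₄, k₅, kn, rfl⟩ := exists_pentagonWalk_of_mem_cyclesThrough hC
      rcases huniq x y z k₂ k₃ k₄ k₅ kn with ⟨rfl, rfl, rfl⟩ | ⟨rfl, rfl, rfl⟩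
      · exact Or.inl rfl
      · exact Or.inr rfl
    · rintro (rfl | rfl)
      · refine ⟨?_, u, _, pentagonWalk_isCycle h₁ h₂ h₃ h₄ h₅ hn, rfl, rfl⟩
        rw [Walk.mem_edges_toSubgraph]; simp [pentagonWalk]
      · refine ⟨?_, u, _, pentagonWalk_isCycle h₁ h₂' h₃' h₄' h₅' hn', rfl, rfl⟩
        rw [Walk.mem_edges_toSubgraph]; simp [pentagonWalk]

end SimpleGraph

/-! ### Walks in the coset graph as words. -/

section CosetGraph

variable {G : Type*} [Group G] {A B : G}

theorem mk_rightCoset_eq_iff {H : Subgroup G} {g g' : G} :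
    rightCoset H g = rightCoset H g' ↔ g' * g⁻¹ ∈ H :=
  Quotient.eq.trans QuotientGroup.rightRel_apply

/-- The element `B A ^ d` or `B⁻¹ A ^ d`, for `s = (true, d)` or `(false, d)`. -/
def cosStep (A B : G) (s : Bool × Bool) : G :=
  (bif s.1 then B else B⁻¹) * (bif s.2 then A else 1)

/-- The product of the steps of a word; the head of the list is the last step. -/
def cosWord (A B : G) : List (Bool × Bool) → G
  | [] => 1
  | s :: l => cosStep A B s * cosWord A B l

theorem cosWord_append (A B : G) (l m : List (Bool × Bool)) :
    cosWord A B (l ++ m) = cosWord A B l * cosWord A B m := by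
  induction l with
  | nil => simp [cosWord]
  | cons s l ih => simp [cosWord, ih, mul_assoc]

theorem cosWord_flatten_replicate (A B : G) (n : ℕ) (l : List (Bool × Bool)) :
    cosWord A B (List.replicate n l).flatten = cosWord A B l ^ n := by
  induction n with
  | zero => simp [cosWord]
  | succ n ih => rw [List.replicate_succ, List.flatten_cons, cosWord_append, ih, pow_succ']

/-- A word is reduced when no step goes back along the preceding one. -/
def IsReducedWord : List (Bool × Bool) → Bool
  | [] => true
  | s :: l => (match l with
    | [] => true
    | t :: _ => !(s.1 == !t.1 && !s.2)) && IsReducedWord l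

/-- All steps. -/
def allSteps : List (Bool × Bool) := [(true, false), (true, true), (false, false), (false, true)]

theorem mem_allSteps (s : Bool × Bool) : s ∈ allSteps := by
  revert s; decide

/-- The graph `Cos(G, ⟨A⟩, {B, B⁻¹})`. -/
abbrev pairGraph (A B : G) : SimpleGraph (RightCosets (Subgroup.zpowers A)) :=
  cosGraph (Subgroup.zpowers A) {B, B⁻¹} (pair_inv_eq B)

/-- The vertex `⟨A⟩ g`. -/
abbrev pairVertex (A : G) (g : G) : RightCosets (Subgroup.zpowers A) :=
  rightCoset (Subgroup.zpowers A) g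

theorem mem_zpowers_involution (hA : A * A = 1) {x : G} :
    x ∈ Subgroup.zpowers A ↔ x = 1 ∨ x = A := by
  constructor
  · rintro ⟨n, rfl⟩
    have h2 : A ^ (2 : ℤ) = 1 := by rw [zpow_ofNat, pow_two, hA]
    rcases Int.even_or_odd' n with ⟨k, rfl | rfl⟩
    · left; simp [zpow_mul, h2]
    · right; simp [zpow_add, zpow_mul, h2]
  · rintro (rfl | rfl)
    · exact one_mem _
    · exact Subgroup.mem_zpowers _

theorem cosStep_mem (hA : A * A = 1) (s : Bool × Bool) :
    cosStep A B s ∈ ((Subgroup.zpowers A : Subgroup G) : Set G) * {B, B⁻¹} *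
      (Subgroup.zpowers A : Subgroup G) := by
  refine Set.mul_mem_mul (a := bif s.1 then B else B⁻¹) ?_ ?_
  · refine ⟨1, one_mem _, _, ?_, one_mul _⟩
    cases s.1 <;> simp
  · rw [SetLike.mem_coe, mem_zpowers_involution hA]
    cases s.2 <;> simp

/-- With no A in between, B cancels against B⁻¹, and the remaining power of A is absorbed by the
coset. -/
theorem cosStep_cancel (hA : A * A = 1) {s t : Bool × Bool} (h : s.1 = !t.1) (h' : s.2 = false)
    (g : G) : pairVertex A (cosStep A B s * (cosStep A B t * g)) = pairVertex A g := by
  rw [mk_rightCoset_eq_iff, mem_zpowers_involution hA]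
  have hA' : A⁻¹ = A := inv_eq_of_mul_eq_one_left hA
  obtain ⟨s1, s2⟩ := s
  obtain ⟨t1, t2⟩ := t
  simp only at h h'
  subst h h'
  cases t1 <;> cases t2 <;> simp [cosStep, mul_assoc, hA']

theorem pairVertex_cosWord_eq_nil_iff (l : List (Bool × Bool)) :
    pairVertex A (cosWord A B l) = pairVertex A (cosWord A B []) ↔
      cosWord A B l ∈ Subgroup.zpowers A := by
  rw [eq_comm, mk_rightCoset_eq_iff]
  simp [cosWord]

theorem pairVertex_cosWord_ne {l m : List (Bool × Bool)} (hw : cosWord A B m * (cosWord A B l)⁻¹ ∉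
    Subgroup.zpowers A) : pairVertex A (cosWord A B l) ≠ pairVertex A (cosWord A B m) := by
  rwa [Ne, mk_rightCoset_eq_iff]

/-- Hypotheses on a pair `A`, `B` that determine the local structure of the double coset graph up to
distance `2`. -/
structure PentagonPair (A B : G) : Prop where
  mul_self : A * A = 1
  pow_five : B ^ 5 = 1
  pow_five' : (B * A) ^ 5 = 1
  exists_aut : ∃ σ : G ≃* G, σ A = A ∧ σ B = B⁻¹
  closure_eq_top : Subgroup.closure {A, B} = ⊤
  short : ∀ l, l ≠ [] → l.length ≤ 4 → IsReducedWord l = true →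
    cosWord A B l ∉ Subgroup.zpowers A
  long : ∀ s t u v, IsReducedWord [s, t, u, v, (true, false)] = true →
    cosWord A B [s, t, u, v, (true, false)] ∈ Subgroup.zpowers A →
    (t = (true, false) ∧ u = (true, false) ∧ v = (true, false)) ∨
    (t = (true, true) ∧ u = (true, true) ∧ v = (true, true))

namespace PentagonPair

variable (h : PentagonPair A B)
include h

/-- The left factor in H S H is absorbed by the coset, which leaves B or B⁻¹ times 1 or A. The
one-letter case of `short` excludes loops. -/
theorem adj_iff (g : G) (v : RightCosets (Subgroup.zpowers A)) :
    (pairGraph A B).Adj (pairVertex A g) v ↔ ∃ s, v = pairVertex A (cosStep A B s * g) := by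
  constructor
  · obtain ⟨g', rfl⟩ := Quotient.exists_rep v
    intro hadj
    obtain ⟨-, y, ⟨a, ha, s, hs, rfl⟩, b, hb, hy⟩ := (cosGraph_adj _ _ _ g g').mp hadj
    rw [SetLike.mem_coe, mem_zpowers_involution h.mul_self] at hb
    simp only at hy
    obtain ⟨e, he⟩ : ∃ e : Bool, s = bif e then B else B⁻¹ := by
      rcases hs with rfl | hs
      · exact ⟨true, rfl⟩
      · exact ⟨false, hs⟩
    obtain ⟨d, hd⟩ : ∃ d : Bool, b = bif d then A else 1 := by
      rcases hb with rfl | rfl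
      · exact ⟨false, rfl⟩
      · exact ⟨true, rfl⟩
    refine ⟨(e, d), Eq.symm ?_⟩
    change rightCoset _ _ = rightCoset _ g'
    rw [mk_rightCoset_eq_iff]
    have : g' * (cosStep A B (e, d) * g)⁻¹ = a := by
      rw [cosStep, ← he, ← hd, mul_inv_rev, ← mul_assoc, ← hy]
      group
    rwa [this]
  · rintro ⟨s, rfl⟩
    rw [cosGraph_adj]
    have hs : cosStep A B s * g * g⁻¹ = cosStep A B s := by group
    refine ⟨fun heq => ?_, ?_⟩
    · rw [mk_rightCoset_eq_iff, hs] at heq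
      exact h.short [s] (by simp) (by simp) (by simp [IsReducedWord]) (by simpa [cosWord] using heq)
    · rw [hs]
      exact cosStep_mem h.mul_self s

theorem adj_word (s : Bool × Bool) (l : List (Bool × Bool)) :
    (pairGraph A B).Adj (pairVertex A (cosWord A B l)) (pairVertex A (cosWord A B (s :: l))) :=
  (h.adj_iff _ _).mpr ⟨s, rfl⟩

/-- The conclusion is the clause of `IsReducedWord` for the two leading letters, so walks that do
not turn back have reduced words. -/
theorem word_ne {s t : Bool × Bool} {l : List (Bool × Bool)}
    (hne : pairVertex A (cosWord A B (s :: t :: l)) ≠ pairVertex A (cosWord A B l)) :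
    !(s.1 == !t.1 && !s.2) := by
  by_contra hc
  simp only [Bool.not_eq_true', Bool.not_eq_false, Bool.and_eq_true, beq_iff_eq] at hc
  exact hne (cosStep_cancel h.mul_self hc.1 (by simpa using hc.2) _)

theorem base_no_triangle {w : RightCosets (Subgroup.zpowers A)}
    (h₁ : (pairGraph A B).Adj (pairVertex A (cosWord A B [(true, false)])) w)
    (h₂ : (pairGraph A B).Adj w (pairVertex A (cosWord A B []))) : False := by
  obtain ⟨s, rfl⟩ := (h.adj_iff _ _).mp h₁
  obtain ⟨t, ht⟩ := (h.adj_iff _ _).mp h₂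
  have r1 := h.word_ne (s := s) (t := (true, false)) (l := []) (fun e => h₂.ne e)
  have r2 := h.word_ne (s := t) (t := s) (l := [(true, false)]) (fun e => by
    have := h.adj_word (true, false) []
    exact this.ne (ht.trans e))
  refine h.short [t, s, (true, false)] (by simp) (by simp) ?_ ((pairVertex_cosWord_eq_nil_iff _).mp ht.symm)
  simp only [IsReducedWord, r1, r2, Bool.and_true]

theorem base_square {a b : RightCosets (Subgroup.zpowers A)}
    (h₁ : (pairGraph A B).Adj (pairVertex A (cosWord A B [(true, false)])) a)
    (h₂ : (pairGraph A B).Adj a b)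
    (h₃ : (pairGraph A B).Adj b (pairVertex A (cosWord A B [])))
    (ha : a ≠ pairVertex A (cosWord A B [])) :
    b = pairVertex A (cosWord A B [(true, false)]) := by
  by_contra hb
  obtain ⟨s, rfl⟩ := (h.adj_iff _ _).mp h₁
  obtain ⟨t, rfl⟩ := (h.adj_iff _ _).mp h₂
  obtain ⟨u, hu⟩ := (h.adj_iff _ _).mp h₃
  have r1 := h.word_ne (s := s) (t := (true, false)) (l := []) ha
  have r2 := h.word_ne (s := t) (t := s) (l := [(true, false)]) hb
  have r3 := h.word_ne (s := u) (t := t) (l := [s, (true, false)]) (fun e => ha (e.symm.trans hu.symm))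
  refine h.short [u, t, s, (true, false)] (by simp) (by simp) ?_
    ((pairVertex_cosWord_eq_nil_iff _).mp hu.symm)
  simp only [IsReducedWord, r1, r2, r3, Bool.and_true]

/-- Tracing the pentagon gives a reduced word of length five in ⟨A⟩, to which `long` applies. The
closing letter stays undetermined, but it adds no vertex. -/
theorem base_pentagon {x y z : RightCosets (Subgroup.zpowers A)}
    (h₁ : (pairGraph A B).Adj (pairVertex A (cosWord A B [(true, false)])) x)
    (h₂ : (pairGraph A B).Adj x y) (h₃ : (pairGraph A B).Adj y z)
    (h₄ : (pairGraph A B).Adj z (pairVertex A (cosWord A B [])))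
    (hn : [pairVertex A (cosWord A B []), pairVertex A (cosWord A B [(true, false)]),
      x, y, z].Nodup) :
    ∃ d, x = pairVertex A (cosWord A B [(true, d), (true, false)]) ∧
      y = pairVertex A (cosWord A B [(true, d), (true, d), (true, false)]) ∧
      z = pairVertex A (cosWord A B [(true, d), (true, d), (true, d), (true, false)]) := by
  simp only [List.nodup_cons, List.mem_cons, List.not_mem_nil, or_false, not_or] at hn
  obtain ⟨⟨-, hx, hy, -⟩, ⟨-, hy', hz'⟩, ⟨-, hzx⟩, -⟩ := hn
  obtain ⟨s, rfl⟩ := (h.adj_iff _ _).mp h₁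
  obtain ⟨t, rfl⟩ := (h.adj_iff _ _).mp h₂
  obtain ⟨u, rfl⟩ := (h.adj_iff _ _).mp h₃
  obtain ⟨v, hv⟩ := (h.adj_iff _ _).mp h₄
  have r1 := h.word_ne (s := s) (t := (true, false)) (l := []) (Ne.symm hx)
  have r2 := h.word_ne (s := t) (t := s) (l := [(true, false)]) (Ne.symm hy')
  have r3 := h.word_ne (s := u) (t := t) (l := [s, (true, false)]) (fun e => hzx e.symm)
  have r4 := h.word_ne (s := v) (t := u) (l := [t, s, (true, false)]) (fun e => hy (hv.trans e))
  rcases h.long v u t s (by simp only [IsReducedWord, r1, r2, r3, r4, Bool.and_true])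
    ((pairVertex_cosWord_eq_nil_iff _).mp hv.symm) with ⟨rfl, rfl, rfl⟩ | ⟨rfl, rfl, rfl⟩
  · exact ⟨false, rfl, rfl, rfl⟩
  · exact ⟨true, rfl, rfl, rfl⟩

/-- The products are B⁵ = 1 and (BA)⁴B = (BA)⁵A⁻¹ = A. -/
theorem word_closes (d : Bool) :
    pairVertex A (cosWord A B [(true, d), (true, d), (true, d), (true, d), (true, false)]) =
      pairVertex A (cosWord A B []) := by
  rw [pairVertex_cosWord_eq_nil_iff, mem_zpowers_involution h.mul_self]
  have h1 := h.pow_five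
  have h2 := h.pow_five'
  cases d
  · left
    rw [← h1]
    simp [cosWord, cosStep, pow_succ, mul_assoc]
  · right
    have : cosWord A B [(true, true), (true, true), (true, true), (true, true), (true, false)] * A
        = 1 := by
      rw [← h2]
      simp [cosWord, cosStep, pow_succ, mul_assoc]
    rw [eq_inv_of_mul_eq_one_left this]
    exact inv_eq_of_mul_eq_one_left h.mul_self

theorem pentagon_nodup (d : Bool) :
    [pairVertex A (cosWord A B []), pairVertex A (cosWord A B [(true, false)]),
      pairVertex A (cosWord A B [(true, d), (true, false)]),
      pairVertex A (cosWord A B [(true, d), (true, d), (true, false)]),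
      pairVertex A (cosWord A B [(true, d), (true, d), (true, d), (true, false)])].Nodup := by
  -- Two vertices of the pentagon differ by the word read between them, so `short` separates them.
  have hs : ∀ l, l ≠ [] → l.length ≤ 3 → IsReducedWord l = true → ∀ m,
      cosWord A B (l ++ m) * (cosWord A B m)⁻¹ ∉ Subgroup.zpowers A := by
    intro l hl hl' hr m
    rw [cosWord_append, mul_inv_cancel_right]
    exact h.short l hl (by omega) hr
  have h0 : ∀ l, l ≠ [] → l.length ≤ 4 → IsReducedWord l = true →
      pairVertex A (cosWord A B []) ≠ pairVertex A (cosWord A B l) := fun l hl hl' hr e =>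
    h.short l hl hl' hr ((pairVertex_cosWord_eq_nil_iff _).mp e.symm)
  simp only [List.nodup_cons, List.mem_cons, List.not_mem_nil, or_false, not_or, not_false_eq_true,
    List.nodup_nil, and_true]
  refine ⟨⟨h0 _ (by simp) (by simp) ?_, h0 _ (by simp) (by simp) ?_, h0 _ (by simp) (by simp) ?_,
    h0 _ (by simp) (by simp) ?_⟩,
    ⟨pairVertex_cosWord_ne (hs [_] (by simp) (by simp) ?_ _), pairVertex_cosWord_ne (hs [_, _] (by simp) (by simp) ?_ _),
      pairVertex_cosWord_ne (hs [_, _, _] (by simp) (by simp) ?_ _)⟩,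
    ⟨pairVertex_cosWord_ne (hs [_] (by simp) (by simp) ?_ _), pairVertex_cosWord_ne (hs [_, _] (by simp) (by simp) ?_ _)⟩,
    pairVertex_cosWord_ne (hs [_] (by simp) (by simp) ?_ _)⟩ <;>
  cases d <;> rfl

end PentagonPair

end CosetGraph

/-! ### Symmetries of the coset graph and their consequences. -/

section CosetGraph

variable {G : Type*} [Group G] {A B : G}

/-- An automorphism of `G` preserving `H` permutes the right cosets of `H`. -/
def rightCosetsCongr {H : Subgroup G} (σ : G ≃* G) (hσ : ∀ x, σ x ∈ H ↔ x ∈ H) :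
    RightCosets H ≃ RightCosets H :=
  Quotient.congr σ.toEquiv (fun a b => by
    change QuotientGroup.rightRel H a b ↔ QuotientGroup.rightRel H (σ a) (σ b)
    rw [QuotientGroup.rightRel_apply, QuotientGroup.rightRel_apply, ← hσ, map_mul, map_inv])

theorem rightCosetsCongr_mk {H : Subgroup G} (σ : G ≃* G) (hσ : ∀ x, σ x ∈ H ↔ x ∈ H) (g : G) :
    rightCosetsCongr σ hσ (rightCoset H g) = rightCoset H (σ g) := rfl

/-- The action of `G` on `Cos(G, ⟨A⟩, {B, B⁻¹})` by right multiplication. -/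
abbrev pairAction (A B : G) : G →* (pairGraph A B ≃g pairGraph A B) :=
  cosAction (Subgroup.zpowers A) {B, B⁻¹} (pair_inv_eq B)

theorem pairAction_mk (a g : G) :
    pairAction A B a (pairVertex A g) = pairVertex A (g * a⁻¹) := rfl

theorem pairAction_vertexTransitive : GraphVertexTransitive (pairAction A B).range := by
  intro u v
  obtain ⟨g, rfl⟩ := Quotient.exists_rep u
  obtain ⟨g', rfl⟩ := Quotient.exists_rep v
  refine ⟨_, ⟨g'⁻¹ * g, rfl⟩, ?_⟩
  exact (pairAction_mk (B := B) _ _).trans (by simp)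

theorem pairVertex_cosWord_base : pairVertex A (cosWord A B []) = pairVertex A 1 ∧
    pairVertex A (cosWord A B [(true, false)]) = pairVertex A B := by
  simp [cosWord, cosStep]

namespace PentagonPair

variable (h : PentagonPair A B)
include h

theorem vertex_mul (d : Bool) (g : G) :
    pairVertex A ((bif d then A else 1) * g) = pairVertex A g := by
  rw [eq_comm, mk_rightCoset_eq_iff, mem_zpowers_involution h.mul_self]
  cases d <;> simp

/-- Since Hg = HAᵈg, a step BAᵈ is the translate of (H, HB) by Aᵈg. A step B⁻¹Aᵈ leads to Hk with k
= B⁻¹Aᵈg, and translation by k takes HB to Hg. -/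
theorem exists_arc_eq {u v : RightCosets (Subgroup.zpowers A)} (huv : (pairGraph A B).Adj u v) :
    ∃ k ∈ (pairAction A B).range,
      (k (pairVertex A 1) = u ∧ k (pairVertex A B) = v) ∨
      (k (pairVertex A B) = u ∧ k (pairVertex A 1) = v) := by
  obtain ⟨g, rfl⟩ := Quotient.exists_rep u
  obtain ⟨⟨e, d⟩, rfl⟩ := (h.adj_iff g v).mp huv
  cases e
  · refine ⟨_, ⟨(cosStep A B (false, d) * g)⁻¹, rfl⟩, Or.inr ⟨?_, ?_⟩⟩
    · rw [pairAction_mk]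
      refine Eq.trans ?_ (h.vertex_mul d g)
      simp [cosStep, mul_assoc]
    · rw [pairAction_mk]; simp
  · refine ⟨_, ⟨((bif d then A else 1) * g)⁻¹, rfl⟩, Or.inl ⟨?_, ?_⟩⟩
    · rw [pairAction_mk, inv_inv, one_mul]
      exact h.vertex_mul d g
    · rw [pairAction_mk, inv_inv]
      simp [cosStep, mul_assoc]

theorem edgeTransitive : GraphEdgeTransitive (pairAction A B).range := by
  have key : ∀ e ∈ (pairGraph A B).edgeSet, ∃ k ∈ (pairAction A B).range,
      Sym2.map k s(pairVertex A 1, pairVertex A B) = e := by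
    intro e
    induction e using Sym2.ind with
    | _ u v =>
      intro he
      obtain ⟨k, hk, ⟨rfl, rfl⟩ | ⟨rfl, rfl⟩⟩ := h.exists_arc_eq he
      · exact ⟨k, hk, rfl⟩
      · exact ⟨k, hk, by simp [Sym2.eq_swap]⟩
  intro e he f hf
  obtain ⟨k, hk, rfl⟩ := key e he
  obtain ⟨l, hl, rfl⟩ := key f hf
  refine ⟨l * k⁻¹, mul_mem hl (inv_mem hk), ?_⟩
  rw [Sym2.map_map]
  congr 1
  ext x
  change (l * k⁻¹ * k) x = l x
  rw [inv_mul_cancel_right]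

theorem adj_one : (pairGraph A B).Adj (pairVertex A 1) (pairVertex A B) :=
  (h.adj_iff _ _).mpr ⟨(true, false), by simp [cosStep]⟩

theorem not_arcTransitive : ¬ GraphArcTransitive (pairAction A B).range := by
  intro hT
  obtain ⟨_, ⟨a, rfl⟩, h1, h2⟩ := hT _ _ _ _ h.adj_one h.adj_one.symm
  rw [pairAction_mk, mk_rightCoset_eq_iff] at h1 h2
  have e1 : B * a ∈ Subgroup.zpowers A := by simpa using h1
  have e2 : a * B⁻¹ ∈ Subgroup.zpowers A := by simpa using h2
  -- By `e2` the element a is AᵈB, and `e1` then concerns the reduced word BAᵈB.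
  have e3 : ∃ d : Bool, B * (bif d then A else 1) * B ∈ Subgroup.zpowers A := by
    rw [mem_zpowers_involution h.mul_self] at e2
    have e2' : a = B ∨ a = A * B := by
      rcases e2 with e | e
      · exact Or.inl (mul_inv_eq_one.mp e)
      · exact Or.inr (mul_inv_eq_iff_eq_mul.mp e)
    rcases e2' with rfl | rfl
    · exact ⟨false, by simpa using e1⟩
    · exact ⟨true, by simpa [mul_assoc] using e1⟩
  obtain ⟨d, hd⟩ := e3
  refine h.short [(true, d), (true, false)] (by simp) (by simp) (by cases d <;> rfl) ?_
  simpa [cosWord, cosStep] using hd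

theorem halfArcTransitive : GraphHalfArcTransitive (pairAction A B).range :=
  ⟨pairAction_vertexTransitive, h.edgeTransitive, h.not_arcTransitive⟩

/-- The automorphism σ exchanges the steps BAᵈ and B⁻¹Aᵈ, so it acts on the graph, fixing H and
sending HB to HB⁻¹. Right multiplication by B then gives HB and H. -/
theorem exists_swap : ∃ k : pairGraph A B ≃g pairGraph A B,
    k (pairVertex A 1) = pairVertex A B ∧ k (pairVertex A B) = pairVertex A 1 := by
  obtain ⟨σ, hA, hB⟩ := h.exists_aut
  have hσ : ∀ x, σ x ∈ Subgroup.zpowers A ↔ x ∈ Subgroup.zpowers A := by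
    intro x
    rw [mem_zpowers_involution h.mul_self, mem_zpowers_involution h.mul_self]
    rw [EmbeddingLike.map_eq_one_iff, ← hA, σ.injective.eq_iff, hA]
  have hstep : ∀ e d, σ (cosStep A B (e, d)) = cosStep A B (!e, d) := by
    intro e d
    cases e <;> cases d <;> simp [cosStep, hA, hB]
  have hfwd : ∀ u v, (pairGraph A B).Adj u v →
      (pairGraph A B).Adj (rightCosetsCongr σ hσ u) (rightCosetsCongr σ hσ v) := by
    intro u v huv
    obtain ⟨g, rfl⟩ := Quotient.exists_rep u
    obtain ⟨⟨e, d⟩, rfl⟩ := (h.adj_iff g v).mp huv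
    refine (h.adj_iff (σ g) _).mpr ⟨(!e, d), ?_⟩
    rw [rightCosetsCongr_mk, map_mul, hstep]
  have hbwd : ∀ u v, (pairGraph A B).Adj (rightCosetsCongr σ hσ u) (rightCosetsCongr σ hσ v) →
      (pairGraph A B).Adj u v := by
    intro u v huv
    obtain ⟨g, rfl⟩ := Quotient.exists_rep u
    obtain ⟨⟨e, d⟩, he⟩ := (h.adj_iff (σ g) _).mp huv
    refine (h.adj_iff g _).mpr ⟨(!e, d), (rightCosetsCongr σ hσ).injective ?_⟩
    rw [he, rightCosetsCongr_mk, map_mul, hstep, Bool.not_not]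
  let φ : pairGraph A B ≃g pairGraph A B := ⟨rightCosetsCongr σ hσ, fun {u v} => ⟨hbwd u v, hfwd u v⟩⟩
  refine ⟨pairAction A B B⁻¹ * φ, ?_, ?_⟩
  · change pairAction A B B⁻¹ (pairVertex A (σ 1)) = _
    rw [pairAction_mk]; simp
  · change pairAction A B B⁻¹ (pairVertex A (σ B)) = _
    rw [pairAction_mk, hB]; simp

/-- Every arc is the image of the arc `(H, H B)` under an automorphism. -/
theorem exists_iso_arc {u v : RightCosets (Subgroup.zpowers A)} (huv : (pairGraph A B).Adj u v) :
    ∃ k : pairGraph A B ≃g pairGraph A B, k (pairVertex A 1) = u ∧ k (pairVertex A B) = v := by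
  obtain ⟨k, -, hk | ⟨h1, h2⟩⟩ := h.exists_arc_eq huv
  · exact ⟨k, hk⟩
  · obtain ⟨s, hs1, hs2⟩ := h.exists_swap
    exact ⟨k * s, by rw [RelIso.mul_apply, hs1, h1], by rw [RelIso.mul_apply, hs2, h2]⟩

theorem arcTransitive : GraphArcTransitive (⊤ : Subgroup (pairGraph A B ≃g pairGraph A B)) := by
  intro u v u' v' h1 h2
  obtain ⟨k, rfl, rfl⟩ := h.exists_iso_arc h1
  obtain ⟨l, rfl, rfl⟩ := h.exists_iso_arc h2
  refine ⟨l * k⁻¹, Subgroup.mem_top _, ?_, ?_⟩ <;>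
  rw [← RelIso.mul_apply, inv_mul_cancel_right]

theorem no_triangle (u v w : RightCosets (Subgroup.zpowers A)) (h₁ : (pairGraph A B).Adj u v)
    (h₂ : (pairGraph A B).Adj v w) : ¬ (pairGraph A B).Adj w u := by
  intro h₃
  obtain ⟨k, rfl, rfl⟩ := h.exists_iso_arc h₁
  obtain ⟨w, rfl⟩ := k.surjective w
  rw [k.map_adj_iff] at h₂ h₃
  rw [← pairVertex_cosWord_base.1] at h₃
  rw [← pairVertex_cosWord_base.2] at h₂
  exact h.base_no_triangle h₂ h₃

theorem square (u v a b : RightCosets (Subgroup.zpowers A)) (h₁ : (pairGraph A B).Adj u v)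
    (h₂ : (pairGraph A B).Adj v a) (h₃ : (pairGraph A B).Adj a b) (h₄ : (pairGraph A B).Adj b u)
    (ha : a ≠ u) : b = v := by
  obtain ⟨k, rfl, rfl⟩ := h.exists_iso_arc h₁
  obtain ⟨a, rfl⟩ := k.surjective a
  obtain ⟨b, rfl⟩ := k.surjective b
  rw [k.map_adj_iff] at h₂ h₃ h₄
  rw [k.injective.ne_iff] at ha
  rw [← pairVertex_cosWord_base.1] at h₄ ha
  rw [← pairVertex_cosWord_base.2] at h₂ ⊢
  rw [h.base_square h₂ h₃ h₄ ha]

theorem pentagon_adj (d : Bool) :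
    (pairGraph A B).Adj (pairVertex A (cosWord A B [(true, d), (true, d), (true, d), (true, false)]))
      (pairVertex A (cosWord A B [])) := by
  have := h.adj_word (true, d) [(true, d), (true, d), (true, d), (true, false)]
  rwa [h.word_closes] at this

theorem girth_eq : (pairGraph A B).girth = 5 :=
  SimpleGraph.girth_eq_five h.no_triangle h.square (h.adj_word _ _) (h.adj_word _ _)
    (h.adj_word _ _) (h.adj_word _ _) (h.pentagon_adj false) (h.pentagon_nodup false)

/-- The quotient of the two words is BAB⁻¹, which is reduced because A stands between B and B⁻¹. -/
theorem pentagon_fork : pairVertex A (cosWord A B [(true, false), (true, false)]) ≠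
    pairVertex A (cosWord A B [(true, true), (true, false)]) := by
  rw [Ne, mk_rightCoset_eq_iff]
  intro hc
  refine h.short [(true, true), (false, false)] (by simp) (by simp) rfl ?_
  simpa [cosWord, cosStep, mul_assoc] using hc

theorem ncard_cyclesThrough (e : Sym2 (RightCosets (Subgroup.zpowers A)))
    (he : e ∈ (pairGraph A B).edgeSet) : (cyclesThrough (pairGraph A B) 5 e).ncard = 2 := by
  induction e using Sym2.ind with
  | _ u v =>
    obtain ⟨k, hu, hv⟩ := h.exists_iso_arc he
    replace hu : k (pairVertex A (cosWord A B [])) = u := hu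
    replace hv : k (pairVertex A (cosWord A B [(true, false)])) = v := by
      rw [pairVertex_cosWord_base.2]; exact hv
    subst hu hv
    refine SimpleGraph.ncard_cyclesThrough_five (Γ := pairGraph A B) he
      (k.map_adj_iff.mpr (h.adj_word (true, false) _)) (k.map_adj_iff.mpr (h.adj_word (true, false) _))
      (k.map_adj_iff.mpr (h.adj_word (true, false) _)) (k.map_adj_iff.mpr (h.pentagon_adj false))
      ((h.pentagon_nodup false).map k.injective)
      (k.map_adj_iff.mpr (h.adj_word (true, true) _)) (k.map_adj_iff.mpr (h.adj_word (true, true) _))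
      (k.map_adj_iff.mpr (h.adj_word (true, true) _)) (k.map_adj_iff.mpr (h.pentagon_adj true))
      ((h.pentagon_nodup true).map k.injective)
      (k.injective.ne h.pentagon_fork) ?_
    intro x y z h₂ h₃ h₄ h₅ hn
    obtain ⟨x, rfl⟩ := k.surjective x
    obtain ⟨y, rfl⟩ := k.surjective y
    obtain ⟨z, rfl⟩ := k.surjective z
    rw [k.map_adj_iff] at h₂ h₃ h₄ h₅
    obtain ⟨d, rfl, rfl, rfl⟩ := h.base_pentagon h₂ h₃ h₄ h₅
      (List.Nodup.of_map k (by simpa only [List.map_cons, List.map_nil] using hn))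
    cases d
    · exact Or.inl ⟨rfl, rfl, rfl⟩
    · exact Or.inr ⟨rfl, rfl, rfl⟩

theorem neighborSet_ncard (v : RightCosets (Subgroup.zpowers A)) :
    ((pairGraph A B).neighborSet v).ncard = 4 := by
  obtain ⟨g, rfl⟩ := Quotient.exists_rep v
  have : (pairGraph A B).neighborSet (pairVertex A g) =
      Set.range (fun s : Bool × Bool => pairVertex A (cosStep A B s * g)) := by
    ext v
    rw [SimpleGraph.mem_neighborSet, h.adj_iff]
    simp only [Set.mem_range, eq_comm]
  change ((pairGraph A B).neighborSet (pairVertex A g)).ncard = 4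
  rw [this, ← Set.image_univ, Set.ncard_image_of_injective, Set.ncard_univ]
  · simp
  · rintro ⟨e, d⟩ ⟨e', d'⟩ hst
    by_contra hne
    simp only [mk_rightCoset_eq_iff] at hst
    have hA' : A⁻¹ = A := inv_eq_of_mul_eq_one_left h.mul_self
    have hAA : ∀ x, A * (A * x) = x := fun x => by rw [← mul_assoc, h.mul_self, one_mul]
    -- This word is the quotient of the two steps; the exponents of A add modulo 2.
    refine h.short [(e', Bool.xor d d'), (!e, false)] (by simp) (by simp) ?_ ?_
    · revert hne
      cases e <;> cases e' <;> cases d <;> cases d' <;> decide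
    · cases e <;> cases e' <;> cases d <;> cases d' <;>
        simp_all [cosWord, cosStep, mul_assoc]

theorem connected : (pairGraph A B).Connected := by
  have key : ∀ g, (pairGraph A B).Reachable (pairVertex A 1) (pairVertex A g) := by
    intro g
    have hg : g ∈ Subgroup.closure {A, B} := by rw [h.closure_eq_top]; trivial
    have hB : ∀ x s, (pairGraph A B).Reachable (pairVertex A x) (pairVertex A (cosStep A B s * x)) :=
      fun x s => ((h.adj_iff _ _).mpr ⟨s, rfl⟩).reachable
    have hA : ∀ x, pairVertex A (A * x) = pairVertex A x := fun x => h.vertex_mul true x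
    induction hg using Subgroup.closure_induction_left with
    | one => exact SimpleGraph.Reachable.refl _
    | mul_left x hx y hy ih =>
      rcases hx with rfl | rfl
      · rw [hA]; exact ih
      · exact ih.trans (by simpa [cosStep] using hB y (true, false))
    | inv_mul_cancel x hx y hy ih =>
      rcases hx with rfl | rfl
      · rw [inv_eq_of_mul_eq_one_left h.mul_self, hA]; exact ih
      · exact ih.trans (by simpa [cosStep] using hB y (false, false))
  have : Nonempty (RightCosets (Subgroup.zpowers A)) := ⟨pairVertex A 1⟩
  refine SimpleGraph.Connected.mk fun u v => ?_
  obtain ⟨g, rfl⟩ := Quotient.exists_rep u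
  obtain ⟨g', rfl⟩ := Quotient.exists_rep v
  exact (key g).symm.trans (key g')

theorem action_injective : Function.Injective (pairAction A B) := by
  rw [injective_iff_map_eq_one]
  intro a ha
  have hfix : ∀ g, g * a⁻¹ * g⁻¹ ∈ Subgroup.zpowers A := by
    intro g
    have := congrArg (fun k : pairGraph A B ≃g pairGraph A B => k (pairVertex A g)) ha
    simp only [pairAction_mk, RelIso.one_apply] at this
    exact mk_rightCoset_eq_iff.mp this.symm
  have h1 : a⁻¹ ∈ Subgroup.zpowers A := by simpa using hfix 1
  rw [mem_zpowers_involution h.mul_self] at h1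
  rcases h1 with h1 | h1
  · exact inv_eq_one.mp h1
  -- If a⁻¹ = A, then fixing HB puts the reduced word BAB⁻¹ in ⟨A⟩.
  · exfalso
    refine h.short [(true, true), (false, false)] (by simp) (by simp) rfl ?_
    simpa [cosWord, cosStep, h1] using hfix B

end PentagonPair

end CosetGraph

/-! ### Arithmetic in the ring of integers of the fifth cyclotomic field -/

/-- Call by value for integers: the kernel evaluates `n` before it passes it on to `f`. -/
def Int.callByValue {α : Type*} (n : ℤ) (f : ℤ → α) : α :=
  match n with
  | .ofNat 0 => f 0
  | .ofNat (k + 1) => f (.ofNat (k + 1))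
  | .negSucc 0 => f (.negSucc 0)
  | .negSucc (k + 1) => f (.negSucc (k + 1))

theorem Int.callByValue_eq {α : Type*} (n : ℤ) (f : ℤ → α) : n.callByValue f = f n := by
  unfold Int.callByValue
  split <;> rfl

/-- The element `a + b ζ + c ζ² + d ζ³` of `ℤ[ζ]`, where `ζ` is a primitive fifth root of unity. -/
structure CycInt where
  (a b c d : ℤ)

namespace CycInt

/-- The element `a + b ζ + c ζ² + d ζ³`, with its coordinates evaluated. -/
def ofInts (a b c d : ℤ) : CycInt :=
  a.callByValue fun a => b.callByValue fun b => c.callByValue fun c => d.callByValue fun d =>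
    ⟨a, b, c, d⟩

theorem ofInts_eq (a b c d : ℤ) : ofInts a b c d = ⟨a, b, c, d⟩ := by
  simp only [ofInts, Int.callByValue_eq]

/-- Call by value for elements of `ℤ[ζ]`. -/
def callByValue {α : Type*} (x : CycInt) (f : CycInt → α) : α :=
  match x with
  | ⟨a, b, c, d⟩ => f ⟨a, b, c, d⟩

theorem callByValue_eq {α : Type*} (x : CycInt) (f : CycInt → α) : x.callByValue f = f x := rfl

/-- Addition in `ℤ[ζ]`. -/
def add (x y : CycInt) : CycInt := ofInts (x.a + y.a) (x.b + y.b) (x.c + y.c) (x.d + y.d)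

/-- Negation in `ℤ[ζ]`. -/
def neg (x : CycInt) : CycInt := ofInts (-x.a) (-x.b) (-x.c) (-x.d)

/-- The reduction of `r₀ + r₁ ζ + ⋯ + r₄ ζ⁴`. -/
def reduce (r₀ r₁ r₂ r₃ r₄ : ℤ) : CycInt :=
  r₄.callByValue fun r₄ =>
  ofInts (r₀ - r₄) (r₁ - r₄) (r₂ - r₄) (r₃ - r₄)

/-- Multiplication in `ℤ[ζ]`. -/
def mul (x y : CycInt) : CycInt :=
  x.callByValue fun x => y.callByValue fun y =>
  reduce (x.a * y.a + x.c * y.d + x.d * y.c) (x.a * y.b + x.b * y.a + x.d * y.d)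
    (x.a * y.c + x.b * y.b + x.c * y.a) (x.a * y.d + x.b * y.c + x.c * y.b + x.d * y.a)
    (x.b * y.d + x.c * y.c + x.d * y.b)

/-- The product of the three nontrivial conjugates. -/
def cofactor (x : CycInt) : CycInt :=
  -- The factors are the images of x under ζ ↦ ζ², ζ³, ζ⁴.
  mul (reduce x.a x.d x.b 0 x.c) (mul (reduce x.a x.c 0 x.b x.d) (reduce x.a 0 x.d x.c x.b))

/-- The absolute value of the norm. -/
def normAbs (x : CycInt) : ℕ :=
  match x.mul x.cofactor with
  | ⟨a, b, c, d⟩ => if b = 0 ∧ c = 0 ∧ d = 0 then a.natAbs else 0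

/-- The greatest common divisor of the norms of the elements of a list. -/
def normGcd : List CycInt → ℕ
  | [] => 0
  | x :: l => Nat.gcd x.normAbs (normGcd l)

variable {R : Type*} [CommRing R]

/-- The value of an element of `ℤ[ζ]` at a root `ξ` of the fifth cyclotomic polynomial. -/
def eval (ξ : R) (x : CycInt) : R := x.a + x.b * ξ + x.c * ξ ^ 2 + x.d * ξ ^ 3

theorem eval_add (ξ : R) (x y : CycInt) : (x.add y).eval ξ = x.eval ξ + y.eval ξ := by
  simp only [eval, add, ofInts_eq]; push_cast; ring

theorem eval_neg (ξ : R) (x : CycInt) : x.neg.eval ξ = -x.eval ξ := by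
  simp only [eval, neg, ofInts_eq]; push_cast; ring

theorem eval_mul {ξ : R} (hξ : 1 + ξ + ξ ^ 2 + ξ ^ 3 + ξ ^ 4 = 0) (x y : CycInt) :
    (x.mul y).eval ξ = x.eval ξ * y.eval ξ := by
  simp only [eval, mul, reduce, Int.callByValue_eq, ofInts_eq, callByValue_eq]
  push_cast
  -- With Φ = 1 + ξ + ⋯ + ξ⁴, the powers ξ⁵ and ξ⁶ are lowered by 1 - ξ⁵ = (1 - ξ)Φ, and ξ⁴ is
  -- eliminated by Φ itself.
  linear_combination ((1 - ξ) * (x.c * y.d + x.d * y.c) + ξ * (1 - ξ) * (x.d * y.d)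
    - (x.b * y.d + x.c * y.c + x.d * y.b)) * hξ

/-- The norm is a multiple of x. That it is a rational integer need not be proved: otherwise
`normAbs` is 0 and the claim is trivial. -/
theorem natCast_normAbs_eq_zero {ξ : R} (hξ : 1 + ξ + ξ ^ 2 + ξ ^ 3 + ξ ^ 4 = 0) {x : CycInt}
    (hx : x.eval ξ = 0) : (x.normAbs : R) = 0 := by
  have h := eval_mul hξ x x.cofactor
  rw [hx, zero_mul] at h
  unfold normAbs
  generalize x.mul x.cofactor = y at h
  obtain ⟨a, b, c, d⟩ := y
  simp only
  split_ifs with hy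
  · obtain ⟨rfl, rfl, rfl⟩ := hy
    simp only [eval, Int.cast_zero, zero_mul, add_zero] at h
    rcases Int.natAbs_eq a with ha | ha
    · rw [← Int.cast_natCast, ← ha, h]
    · rw [← Int.cast_natCast, ← neg_neg (a.natAbs : ℤ), ← ha, Int.cast_neg, h, neg_zero]
  · simp

theorem dvd_normGcd {p : ℕ} {ξ : ZMod p} (hξ : 1 + ξ + ξ ^ 2 + ξ ^ 3 + ξ ^ 4 = 0)
    {l : List CycInt} (hl : ∀ x ∈ l, x.eval ξ = 0) : p ∣ normGcd l := by
  induction l with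
  | nil => exact dvd_zero p
  | cons x l ih =>
    refine Nat.dvd_gcd ?_ (ih fun y hy => hl y (List.mem_cons_of_mem x hy))
    rw [← ZMod.natCast_eq_zero_iff]
    exact natCast_normAbs_eq_zero hξ (hl x List.mem_cons_self)

/-- A sufficient condition for three elements not to vanish simultaneously modulo a prime which does
not divide `30`. -/
def coprimeTest (x y z : CycInt) : Bool :=
  x.callByValue fun x => y.callByValue fun y => z.callByValue fun z =>
    -- The norms of x, y, z may share a prime although the three vanish at different roots modulo
    -- it; further elements of the ideal they generate cut the gcd down. A gcd of 0 fails the test,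
    -- as 30 ^ 12 % 0 = 30 ^ 12.
    30 ^ 12 % normGcd [x, y, z, x.add y, x.add (y.add y), z.add x, z.add y, z.add x.neg] == 0

theorem not_eval_eq_zero {p : ℕ} [Fact p.Prime] (hp : ¬ p ∣ 30) {ξ : ZMod p}
    (hξ : 1 + ξ + ξ ^ 2 + ξ ^ 3 + ξ ^ 4 = 0) {x y z : CycInt} (ht : coprimeTest x y z = true) :
    ¬ (x.eval ξ = 0 ∧ y.eval ξ = 0 ∧ z.eval ξ = 0) := by
  rintro ⟨hx, hy, hz⟩
  simp only [coprimeTest, callByValue_eq, beq_iff_eq] at ht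
  refine hp ((Fact.out : p.Prime).dvd_of_dvd_pow (n := 12)
    ((dvd_normGcd hξ ?_).trans (Nat.dvd_of_mod_eq_zero ht)))
  simp [eval_add, eval_neg, hx, hy, hz]

end CycInt

/-- Two by two matrices over `ℤ[ζ]`. -/
structure CycMat where
  (a b c d : CycInt)

namespace CycMat

open CycInt

/-- Matrix multiplication. -/
def mul (M N : CycMat) : CycMat :=
  match M, N with
  | ⟨a, b, c, d⟩, ⟨a', b', c', d'⟩ =>
    ((a.mul a').add (b.mul c')).callByValue fun x => ((a.mul b').add (b.mul d')).callByValue fun y =>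
    ((c.mul a').add (d.mul c')).callByValue fun z => ((c.mul b').add (d.mul d')).callByValue fun w =>
    ⟨x, y, z, w⟩

/-- The identity matrix. -/
def one : CycMat := ⟨⟨1, 0, 0, 0⟩, ⟨0, 0, 0, 0⟩, ⟨0, 0, 0, 0⟩, ⟨1, 0, 0, 0⟩⟩

/-- The matrix of the step `s`. -/
def step : Bool × Bool → CycMat
  | (true, false) => ⟨⟨0, 1, 0, 0⟩, ⟨-1, 0, -1, -1⟩, ⟨0, 0, 0, 0⟩, ⟨-1, -1, -1, -1⟩⟩
  | (true, true) => ⟨⟨1, 0, 1, 1⟩, ⟨0, 1, 0, 0⟩, ⟨1, 1, 1, 1⟩, ⟨0, 0, 0, 0⟩⟩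
  | (false, false) => ⟨⟨-1, -1, -1, -1⟩, ⟨1, 0, 1, 1⟩, ⟨0, 0, 0, 0⟩, ⟨0, 1, 0, 0⟩⟩
  | (false, true) => ⟨⟨-1, 0, -1, -1⟩, ⟨-1, -1, -1, -1⟩, ⟨0, -1, 0, 0⟩, ⟨0, 0, 0, 0⟩⟩

/-- The matrix of a word. -/
def word : List (Bool × Bool) → CycMat
  | [] => one
  | s :: l => (step s).mul (word l)

variable {R : Type*} [CommRing R]

/-- The value of a matrix over `ℤ[ζ]` at `ξ`. -/
def eval (ξ : R) (M : CycMat) : Matrix (Fin 2) (Fin 2) R :=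
  !![M.a.eval ξ, M.b.eval ξ; M.c.eval ξ, M.d.eval ξ]

theorem eval_mul {ξ : R} (hξ : 1 + ξ + ξ ^ 2 + ξ ^ 3 + ξ ^ 4 = 0) (M N : CycMat) :
    (M.mul N).eval ξ = M.eval ξ * N.eval ξ := by
  simp only [eval, mul, CycInt.callByValue_eq, CycInt.eval_add, CycInt.eval_mul hξ, Matrix.mul_fin_two]

theorem eval_one (ξ : R) : one.eval ξ = 1 := by
  simp [eval, one, CycInt.eval, Matrix.one_fin_two]

/-- The matrix is not scalar modulo any prime which does not divide `30`. -/
def scalarTest (M : CycMat) : Bool := coprimeTest M.b M.c (M.a.add M.d.neg)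

/-- The matrix is not a multiple of `!![0, 1; -1, 0]` modulo any prime which does not divide
`30`. -/
def antiTest (M : CycMat) : Bool := coprimeTest M.a M.d (M.b.add M.c)

/-- All words of length `n`. -/
def words : ℕ → List (List (Bool × Bool))
  | 0 => [[]]
  | n + 1 => (words n).flatMap fun l => allSteps.map fun s => s :: l

theorem mem_words (l : List (Bool × Bool)) : l ∈ words l.length := by
  induction l with
  | nil => simp [words]
  | cons s l ih =>
    simp only [words, List.length_cons, List.mem_flatMap, List.mem_map]
    exact ⟨l, ih, s, mem_allSteps s, rfl⟩

/-- The tests for a word. -/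
def wordTest (l : List (Bool × Bool)) : Bool :=
  let M := word l
  M.scalarTest && M.antiTest

theorem wordTest_short : ([1, 2, 3, 4].all fun n => (words n).all fun l =>
    !IsReducedWord l || wordTest l) = true := by
  decide +kernel

/-- The two exceptions are the continuations along the two pentagons; s is left free in them. -/
theorem wordTest_long : ∀ s t u v : Bool × Bool,
    (!IsReducedWord [s, t, u, v, (true, false)] || wordTest [s, t, u, v, (true, false)] ||
    (t == (true, false) && u == (true, false) && v == (true, false)) ||
    (t == (true, true) && u == (true, true) && v == (true, true))) = true := by
  decide +kernel

/-- These are powers of BAB, whose trace is -(ζ + ζ⁻¹)². In one complex embedding this exceeds 2 in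
absolute value, so BAB has infinite order there. It serves to exclude groups all of whose elements
have order at most 5. -/
theorem scalarTest_powers :
    ([3, 4, 5].all fun k => scalarTest (word
    (List.replicate k [(true, true), (true, false)]).flatten)) = true := by
  decide +kernel

theorem word_replicate_five : word (List.replicate 5 (true, false)) = one := rfl

theorem word_replicate_five' : word (List.replicate 5 (true, true)) =
    ⟨⟨-1, 0, 0, 0⟩, ⟨0, 0, 0, 0⟩, ⟨0, 0, 0, 0⟩, ⟨-1, 0, 0, 0⟩⟩ := rfl

end CycMat

section Words

variable {G G' : Type*} [Group G] [Group G']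

theorem map_cosStep (f : G →* G') (A B : G) (s : Bool × Bool) :
    f (cosStep A B s) = cosStep (f A) (f B) s := by
  obtain ⟨e, d⟩ := s
  cases e <;> cases d <;> simp [cosStep]

theorem map_cosWord (f : G →* G') (A B : G) (l : List (Bool × Bool)) :
    f (cosWord A B l) = cosWord (f A) (f B) l := by
  induction l with
  | nil => simp [cosWord]
  | cons s l ih => simp [cosWord, ih, map_cosStep]

end Words

/-! ### Specialising words to SL(2, p) and PSL(2, p). -/

section PSL

open Matrix

variable (p : ℕ) [Fact p.Prime]

/-- The matrix `!![0, 1; -1, 0]` as an element of `SL(2, p)`. -/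
def slA : Matrix.SpecialLinearGroup (Fin 2) (ZMod p) :=
  ⟨!![0, 1; -1, 0], by simp [Matrix.det_fin_two]⟩

/-- The matrix `!![ξ, ξ + ξ⁻¹; 0, ξ⁻¹]` as an element of `SL(2, p)`. -/
def slB (ξ : (ZMod p)ˣ) : Matrix.SpecialLinearGroup (Fin 2) (ZMod p) :=
  ⟨!![(ξ : ZMod p), (ξ : ZMod p) + ((ξ⁻¹ : (ZMod p)ˣ) : ZMod p);
    0, ((ξ⁻¹ : (ZMod p)ˣ) : ZMod p)], by
      rw [Matrix.det_fin_two_of, mul_zero, sub_zero, Units.mul_inv]⟩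

theorem coe_slA : (slA p).1 = !![0, 1; -1, 0] := rfl

theorem coe_slB (ξ : (ZMod p)ˣ) : (slB p ξ).1 = !![(ξ : ZMod p),
    (ξ : ZMod p) + ((ξ⁻¹ : (ZMod p)ˣ) : ZMod p); 0, ((ξ⁻¹ : (ZMod p)ˣ) : ZMod p)] := rfl

/-- The projection from `SL(2, p)` to `PSL(2, p)`. -/
def toPSL2Hom : Matrix.SpecialLinearGroup (Fin 2) (ZMod p) →* PSL2 p :=
  QuotientGroup.mk' (Subgroup.center (Matrix.SpecialLinearGroup (Fin 2) (ZMod p)))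

theorem toPSL2Hom_surjective : Function.Surjective (toPSL2Hom p) :=
  QuotientGroup.mk'_surjective _

theorem toPSL2Hom_slA : toPSL2Hom p (slA p) = pslA p := rfl

theorem toPSL2Hom_slB (ξ : (ZMod p)ˣ) : toPSL2Hom p (slB p ξ) = pslB p ξ := rfl

variable {p}

theorem mem_center_sl2_iff {M : Matrix.SpecialLinearGroup (Fin 2) (ZMod p)} :
    M ∈ Subgroup.center (Matrix.SpecialLinearGroup (Fin 2) (ZMod p)) ↔ M = 1 ∨ M = -1 := by
  rw [Matrix.SpecialLinearGroup.mem_center_iff]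
  constructor
  · rintro ⟨r, hr, hM⟩
    rw [Fintype.card_fin, sq_eq_one_iff] at hr
    rcases hr with rfl | rfl
    · left; apply Subtype.ext; rw [← hM]; simp
    · right; apply Subtype.ext; rw [← hM, map_neg, map_one]; rfl
  · rintro (rfl | rfl)
    · exact ⟨1, by simp, by simp⟩
    · exact ⟨-1, by simp, by rw [map_neg, map_one]; rfl⟩

theorem toPSL2Hom_eq_one_iff {M : Matrix.SpecialLinearGroup (Fin 2) (ZMod p)} :
    toPSL2Hom p M = 1 ↔ M = 1 ∨ M = -1 := by
  rw [← mem_center_sl2_iff]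
  exact QuotientGroup.eq_one_iff M

theorem toPSL2Hom_eq_iff {M N : Matrix.SpecialLinearGroup (Fin 2) (ZMod p)} :
    toPSL2Hom p M = toPSL2Hom p N ↔ M = N ∨ M = -N := by
  rw [← mul_inv_eq_one, ← map_inv, ← map_mul, toPSL2Hom_eq_one_iff, mul_inv_eq_one,
    mul_inv_eq_iff_eq_mul, neg_one_mul]

theorem slA_mul_self : slA p * slA p = -1 := by
  apply Subtype.ext
  ext i j
  rw [Matrix.SpecialLinearGroup.coe_mul, coe_slA, Matrix.SpecialLinearGroup.coe_neg]
  fin_cases i <;> fin_cases j <;> simp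

theorem pslA_mul_self : pslA p * pslA p = 1 := by
  rw [← toPSL2Hom_slA, ← map_mul, slA_mul_self, toPSL2Hom_eq_one_iff]
  exact Or.inr rfl

/-- The preimage of ⟨A⟩ in SL(2, p) is {±1, ±A}. The alternatives are the conditions refuted by
`scalarTest` and `antiTest`. -/
theorem eval_eq_zero_of_mem_zpowers {M : Matrix.SpecialLinearGroup (Fin 2) (ZMod p)} {N : CycMat}
    {ξ : ZMod p} (hMN : (M : Matrix (Fin 2) (Fin 2) (ZMod p)) = N.eval ξ)
    (hM : toPSL2Hom p M ∈ Subgroup.zpowers (pslA p)) :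
    (N.b.eval ξ = 0 ∧ N.c.eval ξ = 0 ∧ (N.a.add N.d.neg).eval ξ = 0) ∨
    (N.a.eval ξ = 0 ∧ N.d.eval ξ = 0 ∧ (N.b.add N.c).eval ξ = 0) := by
  rw [mem_zpowers_involution pslA_mul_self, ← toPSL2Hom_slA, toPSL2Hom_eq_one_iff,
    toPSL2Hom_eq_iff] at hM
  have e : N.a.eval ξ = M.1 0 0 ∧ N.b.eval ξ = M.1 0 1 ∧ N.c.eval ξ = M.1 1 0 ∧
      N.d.eval ξ = M.1 1 1 := by
    rw [hMN]; simp [CycMat.eval]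
  rw [CycInt.eval_add, CycInt.eval_add, CycInt.eval_neg, e.1, e.2.1, e.2.2.1, e.2.2.2]
  rcases hM with (rfl | rfl) | (rfl | rfl)
  · left; simp
  · left; simp
  · right; simp [coe_slA]
  · right; simp [Matrix.SpecialLinearGroup.coe_neg, coe_slA]

variable {ξ : (ZMod p)ˣ}

theorem inv_eq_of_cyclotomic
    (hξ : 1 + (ξ : ZMod p) + (ξ : ZMod p) ^ 2 + (ξ : ZMod p) ^ 3 + (ξ : ZMod p) ^ 4 = 0) :
    ((ξ⁻¹ : (ZMod p)ˣ) : ZMod p) = -1 - ξ - (ξ : ZMod p) ^ 2 - (ξ : ZMod p) ^ 3 := by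
  apply mul_left_cancel₀ ξ.ne_zero
  rw [Units.mul_inv]
  linear_combination hξ

theorem coe_cosStep
    (hξ : 1 + (ξ : ZMod p) + (ξ : ZMod p) ^ 2 + (ξ : ZMod p) ^ 3 + (ξ : ZMod p) ^ 4 = 0)
    (s : Bool × Bool) :
    (cosStep (slA p) (slB p ξ) s).1 =
      (CycMat.step s).eval (ξ : ZMod p) := by
  have h := inv_eq_of_cyclotomic hξ
  obtain ⟨e, d⟩ := s
  cases e <;> cases d <;>
    simp only [cosStep, cond_true, cond_false, mul_one, Matrix.SpecialLinearGroup.coe_mul,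
      Matrix.SpecialLinearGroup.coe_inv, coe_slA, coe_slB, Matrix.adjugate_fin_two_of, h, CycMat.step,
      CycMat.eval, CycInt.eval, Matrix.mul_fin_two] <;>
    ext i j <;> fin_cases i <;> fin_cases j <;> simp <;> ring

theorem coe_cosWord
    (hξ : 1 + (ξ : ZMod p) + (ξ : ZMod p) ^ 2 + (ξ : ZMod p) ^ 3 + (ξ : ZMod p) ^ 4 = 0)
    (l : List (Bool × Bool)) :
    (cosWord (slA p) (slB p ξ) l).1 =
      (CycMat.word l).eval (ξ : ZMod p) := by
  induction l with
  | nil => simp [cosWord, CycMat.word, CycMat.eval_one]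
  | cons s l ih =>
    rw [cosWord, CycMat.word, CycMat.eval_mul hξ, Matrix.SpecialLinearGroup.coe_mul, ih, coe_cosStep hξ]

theorem cosWord_notMem (hp : ¬ p ∣ 30)
    (hξ : 1 + (ξ : ZMod p) + (ξ : ZMod p) ^ 2 + (ξ : ZMod p) ^ 3 + (ξ : ZMod p) ^ 4 = 0)
    {l : List (Bool × Bool)} (hl : CycMat.wordTest l = true) :
    cosWord (pslA p) (pslB p ξ) l ∉ Subgroup.zpowers (pslA p) := by
  intro h
  rw [CycMat.wordTest, Bool.and_eq_true] at hl
  rw [← toPSL2Hom_slB, ← toPSL2Hom_slA, ← map_cosWord, toPSL2Hom_slA] at h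
  rcases eval_eq_zero_of_mem_zpowers (coe_cosWord hξ l) h with h | h
  · exact CycInt.not_eval_eq_zero hp hξ hl.1 h
  · exact CycInt.not_eval_eq_zero hp hξ hl.2 h

theorem cyclotomic_of_orderOf (h : orderOf ξ = 5) :
    1 + (ξ : ZMod p) + (ξ : ZMod p) ^ 2 + (ξ : ZMod p) ^ 3 + (ξ : ZMod p) ^ 4 = 0 := by
  have h5 : (ξ : ZMod p) ^ 5 = 1 := by
    rw [← Units.val_pow_eq_pow_val, ← h, pow_orderOf_eq_one, Units.val_one]
  have h1 : (ξ : ZMod p) - 1 ≠ 0 := by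
    intro h0
    have : ξ = 1 := Units.ext (sub_eq_zero.mp h0)
    rw [this, orderOf_one] at h
    norm_num at h
  apply (mul_right_inj' h1).mp
  linear_combination h5

theorem cosWord_short (hp : ¬ p ∣ 30)
    (hξ : 1 + (ξ : ZMod p) + (ξ : ZMod p) ^ 2 + (ξ : ZMod p) ^ 3 + (ξ : ZMod p) ^ 4 = 0)
    (l : List (Bool × Bool)) (hl : l ≠ []) (hlen : l.length ≤ 4) (hr : IsReducedWord l = true) :
    cosWord (pslA p) (pslB p ξ) l ∉ Subgroup.zpowers (pslA p) := by
  have h := CycMat.wordTest_short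
  rw [List.all_eq_true] at h
  have hpos : 0 < l.length := List.length_pos_iff.mpr hl
  have h1 := h l.length (by
    simp only [List.mem_cons, List.not_mem_nil, or_false]; omega)
  rw [List.all_eq_true] at h1
  have h2 := h1 l (CycMat.mem_words l)
  rw [hr, Bool.not_true, Bool.false_or] at h2
  exact cosWord_notMem hp hξ h2

theorem cosWord_long (hp : ¬ p ∣ 30)
    (hξ : 1 + (ξ : ZMod p) + (ξ : ZMod p) ^ 2 + (ξ : ZMod p) ^ 3 + (ξ : ZMod p) ^ 4 = 0)
    (s t u v : Bool × Bool) (hr : IsReducedWord [s, t, u, v, (true, false)] = true)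
    (hm : cosWord (pslA p) (pslB p ξ) [s, t, u, v, (true, false)] ∈ Subgroup.zpowers (pslA p)) :
    (t = (true, false) ∧ u = (true, false) ∧ v = (true, false)) ∨
    (t = (true, true) ∧ u = (true, true) ∧ v = (true, true)) := by
  have h := CycMat.wordTest_long s t u v
  rw [hr] at h
  have hn : CycMat.wordTest [s, t, u, v, (true, false)] ≠ true := fun ht =>
    cosWord_notMem hp hξ ht hm
  rw [Bool.eq_false_iff.mpr hn] at h
  simpa only [Bool.not_true, Bool.false_or, Bool.or_eq_true, Bool.and_eq_true, beq_iff_eq,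
    and_assoc] using h

theorem cosWord_replicate {G : Type*} [Group G] (A B : G) (n : ℕ) (s : Bool × Bool) :
    cosWord A B (List.replicate n s) = cosStep A B s ^ n := by
  induction n with
  | zero => simp [cosWord]
  | succ n ih => rw [List.replicate_succ, cosWord, ih, pow_succ']

theorem slB_pow_five
    (hξ : 1 + (ξ : ZMod p) + (ξ : ZMod p) ^ 2 + (ξ : ZMod p) ^ 3 + (ξ : ZMod p) ^ 4 = 0) :
    slB p ξ ^ 5 = 1 := by
  have h := coe_cosWord hξ (List.replicate 5 (true, false))
  rw [CycMat.word_replicate_five, CycMat.eval_one, cosWord_replicate] at h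
  simp only [cosStep, cond_true, cond_false, mul_one] at h
  exact Subtype.ext h

/-- The entry ξ + ξ⁻¹ of B gives BA the trace -(ξ + ξ⁻¹), hence the eigenvalues -ξ and -ξ⁻¹. -/
theorem slB_mul_slA_pow_five
    (hξ : 1 + (ξ : ZMod p) + (ξ : ZMod p) ^ 2 + (ξ : ZMod p) ^ 3 + (ξ : ZMod p) ^ 4 = 0) :
    (slB p ξ * slA p) ^ 5 = -1 := by
  have h := coe_cosWord hξ (List.replicate 5 (true, true))
  rw [CycMat.word_replicate_five', cosWord_replicate] at h
  simp only [cosStep, cond_true] at h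
  apply Subtype.ext
  rw [h]
  ext i j
  fin_cases i <;> fin_cases j <;> simp [CycMat.eval, CycInt.eval, Matrix.SpecialLinearGroup.coe_neg]

theorem pslB_pow_five
    (hξ : 1 + (ξ : ZMod p) + (ξ : ZMod p) ^ 2 + (ξ : ZMod p) ^ 3 + (ξ : ZMod p) ^ 4 = 0) :
    pslB p ξ ^ 5 = 1 := by
  rw [← toPSL2Hom_slB, ← map_pow, slB_pow_five hξ, map_one]

theorem pslB_mul_pslA_pow_five
    (hξ : 1 + (ξ : ZMod p) + (ξ : ZMod p) ^ 2 + (ξ : ZMod p) ^ 3 + (ξ : ZMod p) ^ 4 = 0) :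
    (pslB p ξ * pslA p) ^ 5 = 1 := by
  rw [← toPSL2Hom_slB, ← toPSL2Hom_slA, ← map_mul, ← map_pow, slB_mul_slA_pow_five hξ,
    toPSL2Hom_eq_one_iff]
  exact Or.inr rfl

/-- Conjugation by an invertible matrix, as an automorphism of the special linear group. -/
def slConj {F : Type*} [Field F] (P : GL (Fin 2) F) :
    Matrix.SpecialLinearGroup (Fin 2) F ≃* Matrix.SpecialLinearGroup (Fin 2) F where
  toFun M := ⟨P.1 * M.1 * (P⁻¹).1, by rw [Matrix.det_units_conj, M.2]⟩
  invFun M := ⟨(P⁻¹).1 * M.1 * P.1, by rw [Matrix.det_units_conj', M.2]⟩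
  left_inv M := Subtype.ext (by simp [mul_assoc])
  right_inv M := Subtype.ext (by simp [mul_assoc])
  map_mul' M N := by
    apply Subtype.ext
    change P.1 * (M * N).1 * (P⁻¹).1 = (P.1 * M.1 * (P⁻¹).1) * (P.1 * N.1 * (P⁻¹).1)
    rw [Matrix.SpecialLinearGroup.coe_mul]
    simp [mul_assoc]

theorem exists_aut_pslA_pslB
    (hξ : 1 + (ξ : ZMod p) + (ξ : ZMod p) ^ 2 + (ξ : ZMod p) ^ 3 + (ξ : ZMod p) ^ 4 = 0)
    (h2 : (2 : ZMod p) ≠ 0) :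
    ∃ σ : PSL2 p ≃* PSL2 p, σ (pslA p) = pslA p ∧ σ (pslB p ξ) = (pslB p ξ)⁻¹ := by
  obtain ⟨x, hx⟩ : ∃ x : ZMod p, (ξ : ZMod p) = x := ⟨_, rfl⟩
  obtain ⟨y, hy⟩ : ∃ y : ZMod p, ((ξ⁻¹ : (ZMod p)ˣ) : ZMod p) = y := ⟨_, rfl⟩
  have hx0 : x ≠ 0 := hx ▸ ξ.ne_zero
  have hxy : x * y = 1 := by rw [← hx, ← hy, Units.mul_inv]
  have hinv : y = x ^ 4 := by
    rw [← hy, inv_eq_of_cyclotomic hξ, ← hx]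
    linear_combination -hξ
  rw [hx] at hξ
  -- Symmetric matrices of trace zero anticommute with A; the equation XB = B⁻¹X then fixes the
  -- ratio of the entries.
  let X : Matrix (Fin 2) (Fin 2) (ZMod p) := !![x + y, y - x; y - x, -(x + y)]
  have hX : X.det ≠ 0 := by
    -- Here det X = -2(x² + y²) with y² = x³, and (x² + x³)(x + x³) = 1 + x + x³ + x⁴ = -x².
    have : X.det * (x + x ^ 3) = 2 * x ^ 2 := by
      rw [Matrix.det_fin_two_of, hinv]
      linear_combination (-2 * x ^ 2 * (1 + (x ^ 2 + x ^ 4) * (x - 1))) * hξ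
    intro h0
    rw [h0, zero_mul] at this
    exact mul_ne_zero h2 (pow_ne_zero 2 hx0) this.symm
  let P : GL (Fin 2) (ZMod p) := Matrix.GeneralLinearGroup.mkOfDetNeZero X hX
  have hconj : ∀ M N : Matrix.SpecialLinearGroup (Fin 2) (ZMod p), X * M.1 = N.1 * X →
      slConj P M = N := by
    intro M N hMN
    apply Subtype.ext
    change P.1 * M.1 * (P⁻¹).1 = N.1
    have hP : P.1 = X := rfl
    rw [hP, hMN, ← hP, mul_assoc, ← Units.val_mul, mul_inv_cancel, Units.val_one, mul_one]
  have hc : (Subgroup.center (Matrix.SpecialLinearGroup (Fin 2) (ZMod p))).map (slConj P).toMonoidHom =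
      Subgroup.center (Matrix.SpecialLinearGroup (Fin 2) (ZMod p)) :=
    Subgroup.characteristic_iff_map_eq.mp inferInstance (slConj P)
  let σ : PSL2 p ≃* PSL2 p := QuotientGroup.congr _ _ (slConj P) hc
  have hσ : ∀ M, σ (toPSL2Hom p M) = toPSL2Hom p (slConj P M) := fun M => rfl
  refine ⟨σ, ?_, ?_⟩
  · rw [← toPSL2Hom_slA, hσ, hconj (slA p) (-slA p), toPSL2Hom_eq_iff]
    · exact Or.inr rfl
    · rw [Matrix.SpecialLinearGroup.coe_neg, coe_slA]
      ext i j
      fin_cases i <;> fin_cases j <;> simp [X]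
  · rw [← toPSL2Hom_slB, ← map_inv, hσ, hconj (slB p ξ) (slB p ξ)⁻¹]
    rw [Matrix.SpecialLinearGroup.coe_inv, coe_slB, Matrix.adjugate_fin_two_of, hx, hy]
    ext i j
    fin_cases i <;> fin_cases j <;> simp [X] <;> ring

end PSL

/-! ### Klein's orbit count. -/

section Burnside

/-- If x or y is not n/2, the sum is at most n/2 + n/3 + n/6 = n, a contradiction; so x = y = n/2
and z = 2. -/
theorem eq_two_of_three_orbits {n x y z e f g : ℕ} (hx : x * e = n) (hy : y * f = n)
    (hz : z * g = n) (he : 2 ≤ e) (hf : 2 ≤ f) (hg : 6 ≤ g) (hsum : x + y + z = n + 2) : z = 2 := by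
  have h1 : 6 * z ≤ n := by nlinarith
  have h2 : 2 * x = n ∨ 3 * x ≤ n := by
    rcases he.eq_or_lt with rfl | h
    · left; omega
    · right; nlinarith
  have h3 : 2 * y = n ∨ 3 * y ≤ n := by
    rcases hf.eq_or_lt with rfl | h
    · left; omega
    · right; nlinarith
  omega

variable {K X : Type*} [Group K] [Finite K] [MulAction K X] [Finite X]

open MulAction

/-- By Burnside's lemma the number of orbits times |K| is |X| + 2(|K| - 1), and |X| is the sum of
the indices. -/
theorem sum_card_sub_index_stabilizer (h2 : ∀ g : K, g ≠ 1 → Nat.card (fixedBy X g) = 2)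
    [Fintype (orbitRel.Quotient K X)] :
    ∑ ω : orbitRel.Quotient K X, (Nat.card K - (stabilizer K ω.out).index) =
      2 * (Nat.card K - 1) := by
  classical
  have := Fintype.ofFinite K
  have := Fintype.ofFinite X
  have hB := MulAction.sum_card_fixedBy_eq_card_orbits_mul_card_group K X
  have hcard : Fintype.card X = ∑ ω : orbitRel.Quotient K X, (stabilizer K ω.out).index := by
    rw [Fintype.card_congr (selfEquivSigmaOrbits' K X), Fintype.card_sigma]
    refine Finset.sum_congr rfl fun ω _ => ?_
    rw [index_stabilizer, ← Nat.card_coe_set_eq, ← Nat.card_eq_fintype_card,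
      orbitRel.Quotient.orbit_eq_orbit_out ω Quotient.out_eq']
  have hle : ∀ ω : orbitRel.Quotient K X, (stabilizer K ω.out).index ≤ Nat.card K := fun ω =>
    Nat.le_of_dvd Nat.card_pos (Subgroup.index_dvd_card _)
  have hsum : ∑ g : K, Fintype.card (fixedBy X g) = Fintype.card X + 2 * (Nat.card K - 1) := by
    rw [← Finset.add_sum_erase _ _ (Finset.mem_univ (1 : K))]
    congr 1
    · refine Fintype.card_congr ((Equiv.setCongr ?_).trans (Equiv.Set.univ X))
      ext x; simp
    · rw [Finset.sum_congr rfl (g := fun _ => 2)]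
      · simp [Nat.card_eq_fintype_card, mul_comm]
      · intro g hg
        rw [← Nat.card_eq_fintype_card]
        exact h2 g (Finset.ne_of_mem_erase hg)
  have htot : ∑ ω : orbitRel.Quotient K X, (Nat.card K - (stabilizer K ω.out).index) +
      ∑ ω : orbitRel.Quotient K X, (stabilizer K ω.out).index =
      Fintype.card (orbitRel.Quotient K X) * Nat.card K := by
    rw [← Finset.sum_add_distrib, Finset.sum_congr rfl (g := fun _ => Nat.card K)]
    · simp
    · intro ω _
      exact Nat.sub_add_cancel (hle ω)
  rw [← hcard] at htot
  have hB' : Fintype.card X + 2 * (Nat.card K - 1) =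
      Fintype.card (orbitRel.Quotient K X) * Nat.card K := by
    rw [← hsum, Nat.card_eq_fintype_card]
    convert hB
  omega

/-- A finite group acting in such a way that every nontrivial element has exactly two fixed points
has a global fixed point or an orbit of length two, or all its elements have order at most five. -/
theorem fixedPoint_or_orbit_two_or_pow_eq_one
    (h2 : ∀ g : K, g ≠ 1 → Nat.card (fixedBy X g) = 2) :
    (∃ x : X, ∀ g : K, g • x = x) ∨ (∃ x : X, (stabilizer K x).index = 2) ∨
    ∀ g : K, g ^ 3 = 1 ∨ g ^ 4 = 1 ∨ g ^ 5 = 1 := by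
  classical
  have := Fintype.ofFinite (orbitRel.Quotient K X)
  have hsum := sum_card_sub_index_stabilizer (X := X) h2
  obtain ⟨n, hn⟩ : ∃ n, n = Nat.card K := ⟨_, rfl⟩
  rw [← hn] at hsum
  by_cases hn1 : n = 1
  · right; right
    intro g
    left
    have := (Nat.card_eq_one_iff_unique.mp (hn ▸ hn1)).1
    exact Subsingleton.elim _ _
  have hnpos : 0 < n := hn ▸ Nat.card_pos
  have horb : ∀ x : X, (stabilizer K x).index * Nat.card (stabilizer K x) = n := fun x =>
    hn ▸ Subgroup.index_mul_card _
  have hidx : ∀ x : X, 0 < (stabilizer K x).index := fun x =>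
    Nat.pos_of_ne_zero Subgroup.index_ne_zero_of_finite
  have hst : ∀ x : X, 0 < Nat.card (stabilizer K x) := fun x => Nat.card_pos
  let S : Finset (orbitRel.Quotient K X) :=
    Finset.univ.filter fun ω => 2 ≤ Nat.card (stabilizer K ω.out)
  have hS : ∑ ω ∈ S, (n - (stabilizer K ω.out).index) = 2 * (n - 1) := by
    rw [← hsum]
    refine Finset.sum_subset (Finset.subset_univ S) fun ω _ hω => ?_
    have h1 : Nat.card (stabilizer K ω.out) = 1 := by
      have := hst ω.out
      simp only [S, Finset.mem_filter, Finset.mem_univ, true_and] at hω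
      omega
    have := horb ω.out
    rw [h1] at this
    omega
  -- Each orbit in S contributes between n/2 and n - 1 to the total 2(n - 1), so S has two or three
  -- members.
  have hlow : ∀ ω ∈ S, n ≤ 2 * (n - (stabilizer K ω.out).index) := by
    intro ω hω
    simp only [S, Finset.mem_filter, Finset.mem_univ, true_and] at hω
    have := horb ω.out
    have : 2 * (stabilizer K ω.out).index ≤ n := by nlinarith
    omega
  have hup : ∀ ω ∈ S, n - (stabilizer K ω.out).index ≤ n - 1 := by
    intro ω _
    have := hidx ω.out
    omega
  have hc1 : S.card * n ≤ 2 * (2 * (n - 1)) := by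
    rw [← hS, Finset.mul_sum, ← smul_eq_mul]
    exact Finset.card_nsmul_le_sum S _ n hlow
  have hc2 : 2 * (n - 1) ≤ S.card * (n - 1) := by
    rw [← hS, ← smul_eq_mul (S.card)]
    exact Finset.sum_le_card_nsmul S _ _ hup
  have hc3 : S.card ≤ 3 := by
    by_contra! h
    have : 4 * n ≤ S.card * n := Nat.mul_le_mul_right n h
    omega
  have hc4 : 2 ≤ S.card := Nat.le_of_mul_le_mul_right hc2 (by omega)
  have hcase : S.card = 2 ∨ S.card = 3 := by omega
  rcases hcase with hc | hc
  -- Two contributions can reach 2(n - 1) only if both orbits are single points.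
  · left
    obtain ⟨ω, ψ, hne, hSeq⟩ := Finset.card_eq_two.mp hc
    rw [hSeq, Finset.sum_pair hne] at hS
    have h1 := hidx ω.out
    have h3 := hidx ψ.out
    have h4 : (stabilizer K ω.out).index = 1 := by omega
    rw [Subgroup.index_eq_one] at h4
    refine ⟨ω.out, fun g => mem_stabilizer_iff.mp ?_⟩
    rw [h4]; trivial
  · right
    obtain ⟨a, b, c, hab, hac, hbc, hSeq⟩ := Finset.card_eq_three.mp hc
    have hmem : ∀ ω, ω ∈ S ↔ 2 ≤ Nat.card (stabilizer K ω.out) := fun ω => by simp [S]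
    have ha := (hmem a).mp (by simp [hSeq])
    have hb := (hmem b).mp (by simp [hSeq])
    have hc' := (hmem c).mp (by simp [hSeq])
    have hsum3 : (stabilizer K a.out).index + (stabilizer K b.out).index +
        (stabilizer K c.out).index = n + 2 := by
      have e : ∑ ω ∈ S, (n - (stabilizer K ω.out).index) = (n - (stabilizer K a.out).index) +
          ((n - (stabilizer K b.out).index) + (n - (stabilizer K c.out).index)) := by
        rw [hSeq, Finset.sum_insert (by simp [hab, hac]), Finset.sum_pair hbc]
      have hla := hlow a (by simp [hSeq])
      have hlb := hlow b (by simp [hSeq])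
      have hlc := hlow c (by simp [hSeq])
      omega
    -- A stabilizer of order at least 6 would yield an orbit of length two. So all stabilizers in S
    -- have order at most 5, and every g ≠ 1 is conjugate into one; order 2 is covered by g⁴ = 1.
    by_contra! hcon
    obtain ⟨hno, g, hg3, hg4, hg5⟩ := hcon
    have hsmall : ∀ ω ∈ S, Nat.card (stabilizer K ω.out) ≤ 5 := by
      intro ω hω
      by_contra! hbig
      rw [hSeq] at hω
      simp only [Finset.mem_insert, Finset.mem_singleton] at hω
      rcases hω with rfl | rfl | rfl
      · exact hno _ (eq_two_of_three_orbits (horb _) (horb _) (horb _) hb hc' hbig (by omega))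
      · exact hno _ (eq_two_of_three_orbits (horb _) (horb _) (horb _) ha hc' hbig (by omega))
      · exact hno _ (eq_two_of_three_orbits (horb _) (horb _) (horb _) ha hb hbig (by omega))
    have hg1 : g ≠ 1 := by rintro rfl; exact hg3 (one_pow 3)
    obtain ⟨x, hx⟩ : (fixedBy X g).Nonempty := by
      rw [← Set.nonempty_coe_sort]
      exact (Nat.card_pos_iff.mp (by rw [h2 g hg1]; norm_num)).1
    obtain ⟨k, hk⟩ : ∃ k : K, k • x = (Quotient.mk _ x : orbitRel.Quotient K X).out :=
      orbitRel_apply.mp (Quotient.exact (Quotient.out_eq (Quotient.mk (orbitRel K X) x)))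
    let ω : orbitRel.Quotient K X := Quotient.mk _ x
    have hmemst : k * g * k⁻¹ ∈ stabilizer K ω.out := by
      rw [mem_stabilizer_iff, ← hk, ← mul_smul, inv_mul_cancel_right, mul_smul, mem_fixedBy.mp hx]
    have hpow : ∀ m, Nat.card (stabilizer K ω.out) ∣ m → g ^ m = 1 := by
      intro m hm
      have h3 : (⟨_, hmemst⟩ : stabilizer K ω.out) ^ m = 1 := by
        obtain ⟨j, rfl⟩ := hm
        rw [pow_mul, pow_card_eq_one', one_pow]
      have h4 := congrArg Subtype.val h3
      simp only [SubmonoidClass.mk_pow, conj_pow, OneMemClass.coe_one] at h4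
      rwa [conj_eq_one_iff] at h4
    have h5 : 2 ≤ Nat.card (stabilizer K ω.out) := by
      have h6 := hst ω.out
      by_contra! h7
      have := hpow 1 (by rw [show Nat.card (stabilizer K ω.out) = 1 by omega])
      rw [pow_one] at this
      exact hg1 this
    have h6 := hsmall ω ((hmem ω).mpr h5)
    generalize Nat.card (stabilizer K ω.out) = e at h5 h6 hpow
    interval_cases e
    · exact hg4 (hpow 4 (by norm_num))
    · exact hg3 (hpow 3 dvd_rfl)
    · exact hg4 (hpow 4 dvd_rfl)
    · exact hg5 (hpow 5 dvd_rfl)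

end Burnside

/-! ### Transvections and fixed points of Möbius transformations. -/

section Generation

open Matrix

variable {F : Type*} [Field F]

/-- The matrix `!![1, t; 0, 1]`. -/
def slUpper (t : F) : Matrix.SpecialLinearGroup (Fin 2) F := ⟨!![1, t; 0, 1], by simp⟩

theorem slUpper_mul (s t : F) : slUpper s * slUpper t = slUpper (s + t) := by
  apply Subtype.ext
  rw [Matrix.SpecialLinearGroup.coe_mul]
  simp [slUpper, add_comm]

theorem slUpper_zero : slUpper (0 : F) = 1 := by
  apply Subtype.ext; simp [slUpper, Matrix.one_fin_two]

theorem slUpper_pow (t : F) (n : ℕ) : slUpper t ^ n = slUpper (n * t) := by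
  induction n with
  | zero => rw [pow_zero, Nat.cast_zero, zero_mul, slUpper_zero]
  | succ n ih => rw [pow_succ, ih, slUpper_mul]; congr 1; push_cast; ring

/-- Upper unipotents on both sides of g clear its diagonal. The resulting antidiagonal matrix
conjugates upper unipotents to lower ones, and transvections generate SL(2). -/
theorem eq_top_of_slUpper_mem {K : Subgroup (Matrix.SpecialLinearGroup (Fin 2) F)}
    (hK : ∀ t, slUpper t ∈ K) {g : Matrix.SpecialLinearGroup (Fin 2) F} (hg : g ∈ K)
    (hg0 : g.1 1 0 ≠ 0) : K = ⊤ := by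
  have hdet := g.2
  rw [Matrix.det_fin_two] at hdet
  obtain ⟨a, ha⟩ : ∃ a, a = g.1 0 0 := ⟨_, rfl⟩
  obtain ⟨b, hb⟩ : ∃ b, b = g.1 0 1 := ⟨_, rfl⟩
  obtain ⟨c, hc⟩ : ∃ c, c = g.1 1 0 := ⟨_, rfl⟩
  obtain ⟨d, hd⟩ : ∃ d, d = g.1 1 1 := ⟨_, rfl⟩
  have hgm : g.1 = !![a, b; c, d] := by
    rw [ha, hb, hc, hd]; exact Matrix.eta_fin_two g.1
  rw [← ha, ← hb, ← hc, ← hd] at hdet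
  rw [← hc] at hg0
  have hw : slUpper (-a / c) * g * slUpper (-d / c) ∈ K := mul_mem (mul_mem (hK _) hg) (hK _)
  have hwm : (slUpper (-a / c) * g * slUpper (-d / c)).1 = !![0, -1 / c; c, 0] := by
    rw [Matrix.SpecialLinearGroup.coe_mul, Matrix.SpecialLinearGroup.coe_mul, hgm]
    ext i j
    fin_cases i <;> fin_cases j <;> simp [slUpper] <;> field_simp <;>
      first | ring1 | linear_combination hdet | linear_combination -hdet
  generalize slUpper (-a / c) * g * slUpper (-d / c) = w at hw hwm
  have hlow : ∀ t : F, ∃ h ∈ K, h.1 = !![1, 0; t, 1] := by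
    intro t
    refine ⟨w * slUpper (-t / c ^ 2) * w⁻¹, mul_mem (mul_mem hw (hK _)) (inv_mem hw), ?_⟩
    rw [Matrix.SpecialLinearGroup.coe_mul, Matrix.SpecialLinearGroup.coe_mul,
      Matrix.SpecialLinearGroup.coe_inv, hwm, Matrix.adjugate_fin_two_of]
    ext i j
    fin_cases i <;> fin_cases j <;> simp [slUpper] <;> field_simp
  rw [eq_top_iff]
  intro M _
  refine SL2.transvection_induction (fun M => M ∈ K) ?_ (fun _ _ => mul_mem) M
  intro i j hij t
  have key : ∀ h ∈ K, h.1 = Matrix.transvection i j t →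
      Matrix.SpecialLinearGroup.transvection hij t ∈ K := by
    intro h hh he
    convert hh
    exact Subtype.ext he.symm
  fin_cases i <;> fin_cases j
  · exact absurd rfl hij
  · refine key _ (hK t) ?_
    ext i j
    fin_cases i <;> fin_cases j <;> simp [slUpper, Matrix.transvection]
  · obtain ⟨h, hh, he⟩ := hlow t
    refine key h hh ?_
    rw [he]
    ext i j
    fin_cases i <;> fin_cases j <;> simp [Matrix.transvection]
  · exact absurd rfl hij

/-- A subgroup of `SL(2, p)` of order divisible by `p` which fixes no line is the whole group. -/
theorem eq_top_of_dvd_card {p : ℕ} [Fact p.Prime]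
    {K : Subgroup (Matrix.SpecialLinearGroup (Fin 2) (ZMod p))} (hp : p ∣ Nat.card K)
    (hK : ∀ P : Matrix.SpecialLinearGroup (Fin 2) (ZMod p), ∃ g ∈ K, (P⁻¹ * g * P).1 1 0 ≠ 0) :
    K = ⊤ := by
  obtain ⟨⟨u, huK⟩, hu⟩ := exists_prime_orderOf_dvd_card' p hp
  rw [← Subgroup.orderOf_coe] at hu
  change orderOf u = p at hu
  have hup : u ^ p = 1 := orderOf_dvd_iff_pow_eq_one.mp (dvd_of_eq hu)
  -- In characteristic p, (u - 1)ᵖ = uᵖ - 1 = 0, so u fixes a nonzero vector. With this vector as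
  -- first column of P, the conjugate P⁻¹uP is upper unipotent.
  have hdet : (u.1 - 1).det = 0 := by
    have h1 : (u.1 - 1) ^ p = 0 := by
      rw [sub_pow_char_of_commute p (Commute.one_right u.1), one_pow,
        ← Matrix.SpecialLinearGroup.coe_pow, hup,
        Matrix.SpecialLinearGroup.coe_one, sub_self]
    have h2 : (u.1 - 1).det ^ p = 0 := by
      rw [← Matrix.det_pow, h1, Matrix.det_zero]
    exact pow_eq_zero_iff (Fact.out : p.Prime).ne_zero |>.mp h2
  obtain ⟨v, hv0, hv⟩ := Matrix.exists_mulVec_eq_zero_iff.mpr hdet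
  have hcop : IsCoprime (v 0) (v 1) := by
    by_cases h0 : v 0 = 0
    · have h1 : v 1 ≠ 0 := fun h1 => hv0 (by ext i; fin_cases i <;> simp [h0, h1])
      exact ⟨0, (v 1)⁻¹, by simp [h1]⟩
    · exact ⟨(v 0)⁻¹, 0, by simp [h0]⟩
  obtain ⟨P, hP0, hP1⟩ := hcop.exists_SL2_col 0
  have hPv : P.1 *ᵥ ![1, 0] = v := by
    ext i; fin_cases i <;> simp [Matrix.mulVec, dotProduct, Fin.sum_univ_two, hP0, hP1]
  rw [Matrix.sub_mulVec, Matrix.one_mulVec, sub_eq_zero] at hv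
  have hcol : (P⁻¹ * u * P).1 *ᵥ ![1, 0] = ![1, 0] := by
    rw [Matrix.SpecialLinearGroup.coe_mul, Matrix.SpecialLinearGroup.coe_mul,
      ← Matrix.mulVec_mulVec, hPv, ← Matrix.mulVec_mulVec, hv, ← hPv, Matrix.mulVec_mulVec,
      ← Matrix.SpecialLinearGroup.coe_mul, inv_mul_cancel, Matrix.SpecialLinearGroup.coe_one,
      Matrix.one_mulVec]
  obtain ⟨t, ht⟩ : ∃ t, P⁻¹ * u * P = slUpper t := by
    refine ⟨(P⁻¹ * u * P).1 0 1, ?_⟩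
    have hd := (P⁻¹ * u * P).2
    generalize P⁻¹ * u * P = M at hcol hd
    have h0 := congrFun hcol 0
    have h1 := congrFun hcol 1
    simp only [Matrix.mulVec, dotProduct, Fin.sum_univ_two, Matrix.cons_val_zero,
      Matrix.cons_val_one, mul_one, mul_zero, add_zero] at h0 h1
    rw [Matrix.det_fin_two, h0, h1, one_mul, mul_zero, sub_zero] at hd
    apply Subtype.ext
    ext i j
    fin_cases i <;> fin_cases j <;> simp [slUpper, h0, h1, hd]
  have ht0 : t ≠ 0 := by
    rintro rfl
    rw [slUpper_zero] at ht
    have : u = 1 := by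
      have := congrArg (fun x => P * x * P⁻¹) ht
      simpa [mul_assoc] using this
    rw [this, orderOf_one] at hu
    exact (Fact.out : p.Prime).one_lt.ne hu
  let K' := K.map (MulAut.conj P⁻¹).toMonoidHom
  have hmem : ∀ g ∈ K, P⁻¹ * g * P ∈ K' := fun g hg => ⟨g, hg, by simp⟩
  have hK' : K' = ⊤ := by
    obtain ⟨g, hg, hg0⟩ := hK P
    refine eq_top_of_slUpper_mem (fun s => ?_) (hmem g hg) hg0
    -- The multiples of t ≠ 0 exhaust the prime field.
    have : slUpper s = slUpper t ^ (s / t).val := by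
      rw [slUpper_pow, ZMod.natCast_zmod_val, div_mul_cancel₀ s ht0]
    rw [this, ← ht]
    exact pow_mem (hmem u huK) _
  rw [eq_top_iff]
  intro g _
  have : P⁻¹ * g * P ∈ K' := by rw [hK']; trivial
  obtain ⟨h, hh, he⟩ := this
  have : h = g := by simpa using he
  exact this ▸ hh

/-- A Möbius transformation whose discriminant is a nonzero square has exactly two fixed points. -/
theorem card_fixedPoints_eq_two [DecidableEq F] (h2 : (2 : F) ≠ 0) (g : GL (Fin 2) F) {s : F}
    (hs : s ≠ 0) (hdisc : (g.1 0 0 - g.1 1 1) ^ 2 + 4 * g.1 0 1 * g.1 1 0 = s ^ 2) :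
    Nat.card {x : OnePoint F | g • x = x} = 2 := by
  rw [Nat.card_coe_set_eq, Set.ncard_eq_two]
  have hcoe : ∀ z : F, g • (z : OnePoint F) = z ↔
      g.1 1 0 * z ^ 2 + (g.1 1 1 - g.1 0 0) * z - g.1 0 1 = 0 := by
    intro z
    rw [← Matrix.GeneralLinearGroup.fixpointPolynomial_aeval_eq_zero_iff]
    simp [Matrix.GeneralLinearGroup.fixpointPolynomial]
  have hinf : g • (OnePoint.infty : OnePoint F) = OnePoint.infty ↔ g.1 1 0 = 0 :=
    OnePoint.smul_infty_eq_self_iff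
  generalize g.1 0 0 = a at *
  generalize g.1 0 1 = b at *
  generalize g.1 1 0 = c at *
  generalize g.1 1 1 = d at *
  by_cases hc : c = 0
  · have had : d - a ≠ 0 := by
      intro h0
      apply hs
      rw [← sq_eq_zero_iff, ← hdisc, hc]
      linear_combination (d - a) * h0
    refine ⟨OnePoint.infty, ((b / (d - a) : F) : OnePoint F), OnePoint.infty_ne_coe _, ?_⟩
    ext x
    induction x using OnePoint.rec with
    | infty => simp [hinf, hc]
    | coe z =>
      simp only [Set.mem_ofPred_eq, hcoe, hc, Set.mem_insert_iff, Set.mem_singleton_iff,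
        OnePoint.coe_ne_infty, false_or, OnePoint.coe_eq_coe]
      rw [eq_div_iff had]
      constructor
      · intro h; linear_combination h
      · intro h; linear_combination h
  · have h2c : 2 * c ≠ 0 := mul_ne_zero h2 hc
    refine ⟨(((a - d + s) / (2 * c) : F) : OnePoint F), (((a - d - s) / (2 * c) : F) : OnePoint F),
      ?_, ?_⟩
    · rw [Ne, OnePoint.coe_eq_coe, div_left_inj' h2c]
      intro h
      have : 2 * s = 0 := by linear_combination h
      exact (mul_ne_zero h2 hs) this
    · ext x
      induction x using OnePoint.rec with
      | infty => simp [hinf, hc]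
      | coe z =>
        simp only [Set.mem_ofPred_eq, hcoe, Set.mem_insert_iff, Set.mem_singleton_iff,
          OnePoint.coe_eq_coe]
        rw [eq_div_iff h2c, eq_div_iff h2c]
        have hfac : 4 * c * (c * z ^ 2 + (d - a) * z - b) =
            (z * (2 * c) - (a - d + s)) * (z * (2 * c) - (a - d - s)) := by
          linear_combination -hdisc
        have h4 : 4 * c ≠ 0 := by
          rw [show (4 : F) * c = 2 * (2 * c) by ring]; exact mul_ne_zero h2 h2c
        rw [← mul_right_inj' h4, mul_zero, hfac, mul_eq_zero, sub_eq_zero, sub_eq_zero]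

/-- The discriminant is τ² - 4 with τ the trace, so M has a double eigenvalue 1 or -1; passing to M²
removes the sign. -/
theorem sq_sub_one_sq_eq_zero {M : Matrix (Fin 2) (Fin 2) F} (hdet : M.det = 1)
    (hdisc : (M 0 0 - M 1 1) ^ 2 + 4 * M 0 1 * M 1 0 = 0) :
    (M ^ 2 - 1) ^ 2 = 0 := by
  rw [Matrix.det_fin_two] at hdet
  rw [Matrix.eta_fin_two M]
  generalize M 0 0 = a at *
  generalize M 0 1 = b at *
  generalize M 1 0 = c at *
  generalize M 1 1 = d at *
  have hτ : (a + d) ^ 2 = 4 := by linear_combination hdisc + 4 * hdet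
  have hN : !![a, b; c, d] ^ 2 - 1 = !![(a + d) * a - 2, (a + d) * b; (a + d) * c, (a + d) * d - 2] := by
    rw [pow_two, Matrix.mul_fin_two, Matrix.one_fin_two]
    ext i j
    fin_cases i <;> fin_cases j <;> simp
    · linear_combination -hdet
    · ring
    · ring
    · linear_combination -hdet
  rw [hN, pow_two, Matrix.mul_fin_two]
  ext i j
  fin_cases i <;> fin_cases j <;> simp
  · linear_combination (a ^ 2 + b * c) * hτ - 4 * hdet
  · linear_combination (a + d) * b * hτ
  · linear_combination (a + d) * c * hτ
  · linear_combination (d ^ 2 + b * c) * hτ - 4 * hdet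

/-- By Cayley–Hamilton M² = τM - 1, so M² = 1 gives τM = 2 with τ² = 4 ≠ 0, and M is scalar. -/
theorem sq_ne_one_of_disc_eq_zero (h2 : (2 : F) ≠ 0) {M : Matrix (Fin 2) (Fin 2) F}
    (hdet : M.det = 1) (hdisc : (M 0 0 - M 1 1) ^ 2 + 4 * M 0 1 * M 1 0 = 0)
    (hs : ¬ (M 0 1 = 0 ∧ M 1 0 = 0 ∧ M 0 0 = M 1 1)) : M ^ 2 ≠ 1 := by
  intro h
  apply hs
  rw [Matrix.det_fin_two] at hdet
  have e : ∀ i j, (M ^ 2) i j = (1 : Matrix (Fin 2) (Fin 2) F) i j := fun i j => by rw [h]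
  have e00 := e 0 0
  have e01 := e 0 1
  have e10 := e 1 0
  have e11 := e 1 1
  simp only [pow_two, Matrix.mul_apply, Fin.sum_univ_two, Matrix.one_apply_eq, Ne, zero_ne_one,
    one_ne_zero, not_false_eq_true, Matrix.one_apply_ne] at e00 e01 e10 e11
  generalize M 0 0 = a at *
  generalize M 0 1 = b at *
  generalize M 1 0 = c at *
  generalize M 1 1 = d at *
  have hτ : (a + d) ^ 2 = 2 ^ 2 := by linear_combination hdisc + 4 * hdet
  have hτ0 : a + d ≠ 0 := by
    intro h0
    rw [h0] at hτ
    exact pow_ne_zero 2 h2 (by rw [← hτ]; ring)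
  refine ⟨mul_left_cancel₀ hτ0 ?_, mul_left_cancel₀ hτ0 ?_, mul_left_cancel₀ hτ0 ?_⟩
  · linear_combination e01
  · linear_combination e10
  · linear_combination e00 - e11

/-- An element of `SL(2, p)` whose order is prime to `p` and which is not `±1` has a nonzero
discriminant. -/
theorem disc_ne_zero_of_not_dvd_orderOf {p : ℕ} [Fact p.Prime] (hp2 : (2 : ZMod p) ≠ 0)
    {g : Matrix.SpecialLinearGroup (Fin 2) (ZMod p)} (hg : ¬ p ∣ orderOf g)
    (hs : ¬ (g.1 0 1 = 0 ∧ g.1 1 0 = 0 ∧ g.1 0 0 = g.1 1 1)) :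
    (g.1 0 0 - g.1 1 1) ^ 2 + 4 * g.1 0 1 * g.1 1 0 ≠ 0 := by
  intro hdisc
  have hpow : (g ^ 2) ^ p = 1 := by
    have h1 : (g.1 ^ 2 - 1) ^ p = (g.1 ^ 2) ^ p - 1 := by
      rw [sub_pow_char_of_commute p (Commute.one_right _), one_pow]
    rw [pow_eq_zero_of_le (Fact.out : p.Prime).two_le (sq_sub_one_sq_eq_zero g.2 hdisc)] at h1
    apply Subtype.ext
    rw [Matrix.SpecialLinearGroup.coe_pow, Matrix.SpecialLinearGroup.coe_pow,
      Matrix.SpecialLinearGroup.coe_one]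
    exact sub_eq_zero.mp h1.symm
  have hne : g ^ 2 ≠ 1 := by
    intro h
    apply sq_ne_one_of_disc_eq_zero hp2 g.2 hdisc hs
    rw [← Matrix.SpecialLinearGroup.coe_pow, h, Matrix.SpecialLinearGroup.coe_one]
  have hord : orderOf (g ^ 2) = p := orderOf_eq_prime hpow hne
  exact hg ((dvd_of_eq hord.symm).trans (orderOf_pow_dvd 2))

end Generation

/-! ### Generation of SL(2, p) by A and B. -/

section PSLGeneration

open Matrix

variable {p : ℕ} [Fact p.Prime] {ξ : (ZMod p)ˣ}

/-- The transformations `A` and `B` have no common eigenvector over any field of characteristic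
`p`. -/
theorem no_common_eigenvector {F : Type*} [Field F] {x y u v : F} (h2 : (2 : F) ≠ 0)
    (hx : 1 + x + x ^ 2 + x ^ 3 + x ^ 4 = 0) (hxy : x * y = 1)
    (hA : u ^ 2 + v ^ 2 = 0) (hB : (x * u + (x + y) * v) * v = u * (y * v)) : u = 0 ∧ v = 0 := by
  -- `hA` and `hB` say that (u, v) is parallel to its images. Eliminating u leaves (x - y)² + (x +
  -- y)² = 0, which the cyclotomic relation turns into 2x² = 0.
  have hv : v = 0 := by
    by_contra hv
    have h1 : (x - y) * u = -(x + y) * v := by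
      apply mul_right_cancel₀ hv
      linear_combination hB
    have h3 : ((x - y) ^ 2 + (x + y) ^ 2) * v ^ 2 = 0 := by
      linear_combination (x - y) ^ 2 * hA - ((x - y) * u - (x + y) * v) * h1
    have h4 : (x - y) ^ 2 + (x + y) ^ 2 = 0 :=
      (mul_eq_zero.mp h3).resolve_right (pow_ne_zero 2 hv)
    have hy : y = x ^ 4 := by
      have hx0 : x ≠ 0 := left_ne_zero_of_mul_eq_one hxy
      apply mul_left_cancel₀ hx0
      linear_combination hxy - (x - 1) * hx
    have h5 : (2 : F) * x ^ 2 = 0 := by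
      rw [hy] at h4
      linear_combination (-(x + x ^ 3)) * h4 + 2 * x ^ 2 * (1 + (x ^ 2 + x ^ 4) * (x - 1)) * hx
    exact mul_ne_zero h2 (pow_ne_zero 2 (left_ne_zero_of_mul_eq_one hxy)) h5
  refine ⟨?_, hv⟩
  rw [hv] at hA
  exact pow_eq_zero_iff two_ne_zero |>.mp (by linear_combination hA)

/-- The subgroup of `SL(2, p)` generated by the matrices `A` and `B`. -/
def slClosure (p : ℕ) [Fact p.Prime] (ξ : (ZMod p)ˣ) :
    Subgroup (Matrix.SpecialLinearGroup (Fin 2) (ZMod p)) :=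
  Subgroup.closure {slA p, slB p ξ}

theorem slA_mem : slA p ∈ slClosure p ξ := Subgroup.subset_closure (by simp)

theorem slB_mem : slB p ξ ∈ slClosure p ξ := Subgroup.subset_closure (by simp)

theorem slClosure_eq_top_of_dvd (h2 : (2 : ZMod p) ≠ 0)
    (hξ : 1 + (ξ : ZMod p) + (ξ : ZMod p) ^ 2 + (ξ : ZMod p) ^ 3 + (ξ : ZMod p) ^ 4 = 0)
    (hdvd : p ∣ Nat.card (slClosure p ξ)) : slClosure p ξ = ⊤ := by
  refine eq_top_of_dvd_card hdvd fun P => ?_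
  by_contra! h
  have hA := h _ slA_mem
  have hB := h _ slB_mem
  have hdet := P.2
  rw [Matrix.det_fin_two] at hdet
  simp only [Matrix.SpecialLinearGroup.coe_mul, Matrix.SpecialLinearGroup.coe_inv, coe_slA, coe_slB,
    Matrix.adjugate_fin_two, Matrix.mul_apply, Fin.sum_univ_two, Matrix.of_apply, Matrix.cons_val',
    Matrix.cons_val_zero, Matrix.cons_val_one, Matrix.cons_val_fin_one] at hA hB
  obtain ⟨h0, h1⟩ := no_common_eigenvector (u := P.1 0 0) (v := P.1 1 0) h2 hξ ξ.mul_inv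
    (by linear_combination -hA) (by linear_combination -hB)
  rw [h0, h1] at hdet
  simp at hdet

/-- `SL(2, p)` acts on the projective line over the field with `p²` elements. -/
noncomputable def slToGL (p : ℕ) [Fact p.Prime] :
    Matrix.SpecialLinearGroup (Fin 2) (ZMod p) →* GL (Fin 2) (GaloisField p 2) :=
  (Matrix.GeneralLinearGroup.map (algebraMap (ZMod p) (GaloisField p 2))).comp
    Matrix.SpecialLinearGroup.toGL

theorem slToGL_apply (M : Matrix.SpecialLinearGroup (Fin 2) (ZMod p)) (i j : Fin 2) :
    (slToGL p M).1 i j = algebraMap (ZMod p) (GaloisField p 2) (M.1 i j) := rfl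

open Classical in
/-- The permutations of the projective line over the field with `p²` elements given by elements of
`SL(2, p)`. -/
noncomputable def slToPerm (p : ℕ) [Fact p.Prime] :
    Matrix.SpecialLinearGroup (Fin 2) (ZMod p) →* Equiv.Perm (OnePoint (GaloisField p 2)) :=
  (MulAction.toPermHom (GL (Fin 2) (GaloisField p 2)) (OnePoint (GaloisField p 2))).comp (slToGL p)

open Classical in
theorem slToPerm_apply (M : Matrix.SpecialLinearGroup (Fin 2) (ZMod p))
    (x : OnePoint (GaloisField p 2)) : slToPerm p M x = slToGL p M • x := rfl

open Classical in
theorem slToPerm_infty_eq_iff (M : Matrix.SpecialLinearGroup (Fin 2) (ZMod p)) :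
    slToPerm p M OnePoint.infty = OnePoint.infty ↔ M.1 1 0 = 0 := by
  rw [slToPerm_apply, OnePoint.smul_infty_eq_self_iff]
  change algebraMap (ZMod p) (GaloisField p 2) (M.1 1 0) = 0 ↔ _
  exact map_eq_zero_iff _ (algebraMap (ZMod p) (GaloisField p 2)).injective

open Classical in
theorem slToPerm_coe_eq_iff (M : Matrix.SpecialLinearGroup (Fin 2) (ZMod p)) (z : GaloisField p 2) :
    slToPerm p M z = z ↔
      algebraMap _ (GaloisField p 2) (M.1 1 0) * z ^ 2 +
      (algebraMap _ (GaloisField p 2) (M.1 1 1) - algebraMap _ (GaloisField p 2) (M.1 0 0)) * z -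
      algebraMap _ (GaloisField p 2) (M.1 0 1) = 0 := by
  rw [slToPerm_apply, ← Matrix.GeneralLinearGroup.fixpointPolynomial_aeval_eq_zero_iff]
  simp only [← slToGL_apply]
  simp [Matrix.GeneralLinearGroup.fixpointPolynomial]

theorem slToPerm_eq_one_iff (M : Matrix.SpecialLinearGroup (Fin 2) (ZMod p)) :
    slToPerm p M = 1 ↔ M.1 0 1 = 0 ∧ M.1 1 0 = 0 ∧ M.1 0 0 = M.1 1 1 := by
  have hinj := (algebraMap (ZMod p) (GaloisField p 2)).injective
  constructor
  · intro h
    have hi := (slToPerm_infty_eq_iff M).mp (by rw [h]; rfl)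
    have h0 := (slToPerm_coe_eq_iff M 0).mp (by rw [h]; rfl)
    have h1 := (slToPerm_coe_eq_iff M 1).mp (by rw [h]; rfl)
    rw [hi, map_zero] at h0 h1
    have h0' : algebraMap _ (GaloisField p 2) (M.1 0 1) = 0 := by linear_combination -h0
    rw [h0'] at h1
    refine ⟨(map_eq_zero_iff _ hinj).mp h0', hi, hinj ?_⟩
    linear_combination -h1
  · rintro ⟨hb, hc, had⟩
    ext x
    induction x using OnePoint.rec with
    | infty => exact (slToPerm_infty_eq_iff M).mpr hc
    | coe z => exact (slToPerm_coe_eq_iff M z).mpr (by rw [hb, hc, had]; simp)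

theorem exists_sq_eq_algebraMap (h2 : (2 : ZMod p) ≠ 0) (a : ZMod p) :
    ∃ s : GaloisField p 2, algebraMap (ZMod p) (GaloisField p 2) a = s ^ 2 := by
  classical
  by_cases ha : a = 0
  · exact ⟨0, by simp [ha]⟩
  have := Fintype.ofFinite (GaloisField p 2)
  have hodd : Odd p := (Fact.out : p.Prime).odd_of_ne_two (by
    rintro rfl; exact h2 rfl)
  have hcard : Fintype.card (GaloisField p 2) = p ^ 2 := by
    rw [← Nat.card_eq_fintype_card, GaloisField.card p 2 two_ne_zero]
  have hchar : ringChar (GaloisField p 2) ≠ 2 := by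
    rw [ringChar.eq (GaloisField p 2) p]
    rintro rfl
    exact h2 rfl
  have hsq : IsSquare (algebraMap (ZMod p) (GaloisField p 2) a) := by
    rw [FiniteField.isSquare_iff hchar (by simpa using ha), hcard]
    obtain ⟨k, rfl⟩ := hodd
    -- For p = 2k + 1 the exponent in Euler's criterion is (p - 1)(p + 1)/2, and Fermat's theorem
    -- applies.
    have : (2 * k + 1) ^ 2 / 2 = (2 * k + 1 - 1) * (k + 1) := by
      have : (2 * k + 1) ^ 2 = 2 * ((2 * k) * (k + 1)) + 1 := by ring
      rw [this]
      simp only [Nat.add_sub_cancel]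
      omega
    rw [this, pow_mul, ← map_pow, ZMod.pow_card_sub_one_eq_one ha, map_one, one_pow]
  obtain ⟨s, hs⟩ := hsq
  exact ⟨s, by rw [hs, pow_two]⟩

/-- The discriminant is a nonzero element of the prime field, and every such element becomes a
square in the field with p² elements. -/
theorem card_fixedPoints_slToPerm (h2 : (2 : ZMod p) ≠ 0)
    {M : Matrix.SpecialLinearGroup (Fin 2) (ZMod p)} (hM : ¬ p ∣ orderOf M)
    (hne : slToPerm p M ≠ 1) :
    Nat.card {x : OnePoint (GaloisField p 2) | slToPerm p M x = x} = 2 := by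
  classical
  have hinj := (algebraMap (ZMod p) (GaloisField p 2)).injective
  rw [Ne, slToPerm_eq_one_iff] at hne
  have hdisc := disc_ne_zero_of_not_dvd_orderOf h2 hM hne
  obtain ⟨s, hs⟩ := exists_sq_eq_algebraMap h2 ((M.1 0 0 - M.1 1 1) ^ 2 + 4 * M.1 0 1 * M.1 1 0)
  have hs0 : s ≠ 0 := by
    rintro rfl
    apply hdisc
    apply hinj
    rw [hs, map_zero, zero_pow two_ne_zero]
  have h2' : (2 : GaloisField p 2) ≠ 0 := by
    intro h
    apply h2
    apply hinj
    rw [map_ofNat, h, map_zero]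
  have := card_fixedPoints_eq_two h2' (slToGL p M) hs0 (by
    rw [← hs]
    simp only [slToGL_apply, map_add, map_sub, map_mul, map_pow, map_ofNat])
  convert this using 6
  exact slToPerm_apply M _

theorem not_common_fixedPoint (h2 : (2 : ZMod p) ≠ 0)
    (hξ : 1 + (ξ : ZMod p) + (ξ : ZMod p) ^ 2 + (ξ : ZMod p) ^ 3 + (ξ : ZMod p) ^ 4 = 0)
    (x : OnePoint (GaloisField p 2)) (hA : slToPerm p (slA p) x = x)
    (hB : slToPerm p (slB p ξ) x = x) : False := by
  have hinj := (algebraMap (ZMod p) (GaloisField p 2)).injective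
  induction x using OnePoint.rec with
  | infty =>
    rw [slToPerm_infty_eq_iff, coe_slA] at hA
    simp at hA
  | coe z =>
    have h2' : (2 : GaloisField p 2) ≠ 0 := by
      intro h
      apply h2
      apply hinj
      rw [map_ofNat, h, map_zero]
    have hx := congrArg (algebraMap (ZMod p) (GaloisField p 2)) hξ
    have hxy := congrArg (algebraMap (ZMod p) (GaloisField p 2)) ξ.mul_inv
    simp only [map_add, map_mul, map_pow, map_one, map_zero] at hx hxy
    rw [slToPerm_coe_eq_iff, coe_slA] at hA
    rw [slToPerm_coe_eq_iff, coe_slB] at hB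
    simp at hA
    simp only [Matrix.of_apply, Matrix.cons_val', Matrix.cons_val_zero, Matrix.cons_val_one,
      Matrix.cons_val_fin_one, map_zero, map_add] at hB
    have := no_common_eigenvector (u := z) (v := 1) h2' hx hxy (by linear_combination -hA)
      (by linear_combination -hB)
    exact one_ne_zero this.2

theorem slClosure_eq_top (hp : ¬ p ∣ 30)
    (hξ : 1 + (ξ : ZMod p) + (ξ : ZMod p) ^ 2 + (ξ : ZMod p) ^ 3 + (ξ : ZMod p) ^ 4 = 0) :
    slClosure p ξ = ⊤ := by
  have h2 : (2 : ZMod p) ≠ 0 := by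
    intro h
    apply hp
    have : p ∣ 2 := (ZMod.natCast_eq_zero_iff 2 p).mp (by exact_mod_cast h)
    exact this.trans (by norm_num)
  by_contra htop
  have hdvd : ¬ p ∣ Nat.card (slClosure p ξ) := fun h =>
    htop (slClosure_eq_top_of_dvd h2 hξ h)
  have : Finite (OnePoint (GaloisField p 2)) := inferInstanceAs (Finite (Option (GaloisField p 2)))
  let K := (slClosure p ξ).map (slToPerm p)
  have hfix : ∀ g : K, g ≠ 1 →
      Nat.card (MulAction.fixedBy (OnePoint (GaloisField p 2)) g) = 2 := by
    rintro ⟨_, M, hM, rfl⟩ hne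
    refine card_fixedPoints_slToPerm h2 (fun h => hdvd ?_) (fun h => hne (Subtype.ext h))
    exact h.trans (Subgroup.orderOf_dvd_natCard _ hM)
  let a : K := ⟨slToPerm p (slA p), slA p, slA_mem, rfl⟩
  let b : K := ⟨slToPerm p (slB p ξ), slB p ξ, slB_mem, rfl⟩
  rcases fixedPoint_or_orbit_two_or_pow_eq_one hfix with ⟨x, hx⟩ | ⟨x, hx⟩ | hall
  · exact not_common_fixedPoint h2 hξ x (hx a) (hx b)
  · have hb5 : b ^ 5 = 1 := by
      apply Subtype.ext
      change slToPerm p (slB p ξ) ^ 5 = 1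
      rw [← map_pow, slB_pow_five hξ, map_one]
    have hba5 : (b * a) ^ 5 = 1 := by
      apply Subtype.ext
      change (slToPerm p (slB p ξ) * slToPerm p (slA p)) ^ 5 = 1
      rw [← map_mul, ← map_pow, slB_mul_slA_pow_five hξ, slToPerm_eq_one_iff]
      simp [Matrix.SpecialLinearGroup.coe_neg]
    -- If g⁵ = 1 then g = (g³)², and squares lie in any subgroup of index two. So b, ba and hence a
    -- fix x.
    have hodd : ∀ g : K, g ^ 5 = 1 → g ∈ MulAction.stabilizer K x := by
      intro g hg
      have := Subgroup.sq_mem_of_index_two hx (g ^ 3)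
      rwa [← pow_mul, show 3 * 2 = 5 + 1 by norm_num, pow_succ, hg, one_mul] at this
    have hb := hodd b hb5
    have ha : a ∈ MulAction.stabilizer K x :=
      (Subgroup.mul_mem_cancel_left _ hb).mp (hodd _ hba5)
    exact not_common_fixedPoint h2 hξ x ha hb
  -- The element BAB of the group contradicts the bound on orders.
  · have htest := CycMat.scalarTest_powers
    rw [List.all_eq_true] at htest
    let M := cosWord (slA p) (slB p ξ) [(true, true), (true, false)]
    have hM : M ∈ slClosure p ξ := by
      simp only [M, cosWord, cosStep, cond_true, cond_false, mul_one]
      exact mul_mem (mul_mem slB_mem slA_mem) slB_mem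
    have key : ∀ m ∈ [3, 4, 5], (⟨slToPerm p M, M, hM, rfl⟩ : K) ^ m ≠ 1 := by
      intro m hm h
      have h1 : slToPerm p (M ^ m) = 1 := by
        rw [map_pow]; exact congrArg Subtype.val h
      rw [← cosWord_flatten_replicate, slToPerm_eq_one_iff, coe_cosWord hξ] at h1
      refine CycInt.not_eval_eq_zero hp hξ (htest m hm) ?_
      rw [CycInt.eval_add, CycInt.eval_neg]
      obtain ⟨e1, e2, e3⟩ := h1
      exact ⟨e1, e2, by rw [← sub_eq_add_neg, sub_eq_zero]; exact e3⟩
    rcases hall ⟨slToPerm p M, M, hM, rfl⟩ with h | h | h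
    · exact key 3 (by simp) h
    · exact key 4 (by simp) h
    · exact key 5 (by simp) h

theorem closure_pslA_pslB (hp : ¬ p ∣ 30)
    (hξ : 1 + (ξ : ZMod p) + (ξ : ZMod p) ^ 2 + (ξ : ZMod p) ^ 3 + (ξ : ZMod p) ^ 4 = 0) :
    Subgroup.closure {pslA p, pslB p ξ} = ⊤ := by
  have h := congrArg (Subgroup.map (toPSL2Hom p)) (slClosure_eq_top hp hξ)
  rw [slClosure, MonoidHom.map_closure, Set.image_pair, toPSL2Hom_slA, toPSL2Hom_slB,
    Subgroup.map_top_of_surjective _ (toPSL2Hom_surjective p)] at h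
  exact h

end PSLGeneration

/-! ### Group orders and conclusion. -/

section Final

open Matrix

variable {p : ℕ} [Fact p.Prime]

theorem card_sl2 : Nat.card (Matrix.SpecialLinearGroup (Fin 2) (ZMod p)) * (p - 1) =
    (p ^ 2 - 1) * (p ^ 2 - p) := by
  have hGL : Nat.card (GL (Fin 2) (ZMod p)) = (p ^ 2 - 1) * (p ^ 2 - p) := by
    rw [Matrix.card_GL_field, Fin.prod_univ_two, ZMod.card]
    simp
  let f : GL (Fin 2) (ZMod p) →* (ZMod p)ˣ := Matrix.GeneralLinearGroup.det
  have hf : Function.Surjective f := by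
    intro u
    refine ⟨Matrix.GeneralLinearGroup.mkOfDetNeZero !![(u : ZMod p), 0; 0, 1] (by simp), ?_⟩
    apply Units.ext
    change Matrix.det !![(u : ZMod p), 0; 0, 1] = u
    simp
  have hker : Nat.card f.ker = Nat.card (Matrix.SpecialLinearGroup (Fin 2) (ZMod p)) := by
    refine Nat.card_congr ⟨fun g => ⟨g.1.1, congrArg Units.val g.2⟩, fun g => ⟨g.toGL, ?_⟩, ?_, ?_⟩
    · apply Units.ext; exact g.2
    · intro g; apply Subtype.ext; apply Units.ext; rfl
    · intro g; apply Subtype.ext; rfl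
  have hidx : f.ker.index = p - 1 := by
    rw [Subgroup.index_ker, MonoidHom.range_eq_top.mpr hf, Subgroup.card_top,
      Nat.card_eq_fintype_card, ZMod.card_units]
  rw [← hGL, ← hker, ← hidx, Subgroup.card_mul_index]

theorem card_psl2 (h2 : (2 : ZMod p) ≠ 0) :
    2 * Nat.card (PSL2 p) = Nat.card (Matrix.SpecialLinearGroup (Fin 2) (ZMod p)) := by
  have hne : (1 : Matrix.SpecialLinearGroup (Fin 2) (ZMod p)) ≠ -1 := by
    intro h
    have h1 : (1 : ZMod p) = -1 := by
      have := congrArg (fun M : Matrix.SpecialLinearGroup (Fin 2) (ZMod p) => M.1 0 0) h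
      simpa [Matrix.SpecialLinearGroup.coe_neg] using this
    apply h2
    linear_combination h1
  have hcen : Nat.card (Subgroup.center (Matrix.SpecialLinearGroup (Fin 2) (ZMod p))) = 2 := by
    have : (Subgroup.center (Matrix.SpecialLinearGroup (Fin 2) (ZMod p)) :
        Set (Matrix.SpecialLinearGroup (Fin 2) (ZMod p))) = {1, -1} := by
      ext M; exact mem_center_sl2_iff
    rw [← SetLike.coe_sort_coe, this, Nat.card_coe_set_eq, Set.ncard_pair hne]
  have := Subgroup.card_mul_index (Subgroup.center (Matrix.SpecialLinearGroup (Fin 2) (ZMod p)))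
  rwa [hcen] at this

theorem card_rightCosets_pslA (h2 : (2 : ZMod p) ≠ 0) :
    (Nat.card (RightCosets (Subgroup.zpowers (pslA p))) : ℚ) =
      (p : ℚ) * ((p : ℚ) ^ 2 - 1) / 4 := by
  have hA : Nat.card (Subgroup.zpowers (pslA p)) = 2 := by
    rw [Nat.card_zpowers]
    refine orderOf_eq_prime (by rw [pow_two, pslA_mul_self]) ?_
    rw [← toPSL2Hom_slA, Ne, toPSL2Hom_eq_one_iff]
    rintro (h | h)
    · have := congrArg (fun M : Matrix.SpecialLinearGroup (Fin 2) (ZMod p) => M.1 0 1) h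
      simp [coe_slA] at this
    · have := congrArg (fun M : Matrix.SpecialLinearGroup (Fin 2) (ZMod p) => M.1 0 1) h
      simp [coe_slA, Matrix.SpecialLinearGroup.coe_neg] at this
  have hV : Nat.card (RightCosets (Subgroup.zpowers (pslA p))) * 2 = Nat.card (PSL2 p) := by
    rw [Nat.card_congr (QuotientGroup.quotientRightRelEquivQuotientLeftRel _)]
    have := Subgroup.index_mul_card (Subgroup.zpowers (pslA p))
    rwa [hA] at this
  have h3 := card_sl2 (p := p)
  rw [← card_psl2 h2, ← hV] at h3
  have hp1 : 1 < p := (Fact.out : p.Prime).one_lt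
  have h4 : ((2 * (Nat.card (RightCosets (Subgroup.zpowers (pslA p))) * 2) * (p - 1) : ℕ) : ℚ) =
      (((p ^ 2 - 1) * (p ^ 2 - p) : ℕ) : ℚ) := congrArg Nat.cast h3
  push_cast [Nat.cast_sub hp1.le, Nat.cast_sub (Nat.one_le_pow 2 p hp1.le),
    Nat.cast_sub (Nat.le_self_pow two_ne_zero p)] at h4
  have hp0 : ((p : ℚ) - 1) ≠ 0 := by
    rw [sub_ne_zero]; exact_mod_cast hp1.ne'
  apply mul_right_cancel₀ hp0
  linear_combination h4 / 4

theorem pentagonPair_psl (hp : ¬ p ∣ 30) {ξ : (ZMod p)ˣ}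
    (hξ : 1 + (ξ : ZMod p) + (ξ : ZMod p) ^ 2 + (ξ : ZMod p) ^ 3 + (ξ : ZMod p) ^ 4 = 0)
    (h2 : (2 : ZMod p) ≠ 0) : PentagonPair (pslA p) (pslB p ξ) where
  mul_self := pslA_mul_self
  pow_five := pslB_pow_five hξ
  pow_five' := pslB_mul_pslA_pow_five hξ
  exists_aut := exists_aut_pslA_pslB hξ h2
  closure_eq_top := closure_pslA_pslB hp hξ
  short := cosWord_short hp hξ
  long := cosWord_long hp hξ

end Final

theorem proposition6p6 (p : ℕ) [Fact p.Prime] (hp : p ≡ 1 [MOD 10]) :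
    (∃ ξ : (ZMod p)ˣ, orderOf ξ = 5) ∧
    ∀ ξ : (ZMod p)ˣ, orderOf ξ = 5 →
      (pslGraph p ξ).Connected ∧
      (∀ v, ((pslGraph p ξ).neighborSet v).ncard = 4) ∧
      GraphArcTransitive (⊤ : Subgroup (pslGraph p ξ ≃g pslGraph p ξ)) ∧
      (pslGraph p ξ).girth = 5 ∧
      (Nat.card (RightCosets (Subgroup.zpowers (pslA p))) : ℚ) = (p : ℚ) * ((p : ℚ) ^ 2 - 1) / 4 ∧
      Function.Injective (pslAction p ξ) ∧
      GraphHalfArcTransitive (pslAction p ξ).range ∧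
      (∀ e ∈ (pslGraph p ξ).edgeSet, (cyclesThrough (pslGraph p ξ) 5 e).ncard = 2) := by
  have hprime : p.Prime := Fact.out
  have hmod : p % 10 = 1 := hp
  have hp30 : ¬ p ∣ 30 := by
    intro h
    have hle := Nat.le_of_dvd (by norm_num) h
    have hcase : p = 1 ∨ p = 11 ∨ p = 21 := by omega
    rcases hcase with rfl | rfl | rfl
    · exact Nat.not_prime_one hprime
    · omega
    · omega
  have h2 : (2 : ZMod p) ≠ 0 := by
    intro h
    have : p ∣ 2 := (ZMod.natCast_eq_zero_iff 2 p).mp (by exact_mod_cast h)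
    exact hp30 (this.trans (by norm_num))
  refine ⟨?_, fun ξ hξ => ?_⟩
  · have : Fact (Nat.Prime 5) := ⟨by norm_num⟩
    refine exists_prime_orderOf_dvd_card 5 ?_
    rw [ZMod.card_units]
    omega
  · have h := pentagonPair_psl hp30 (cyclotomic_of_orderOf hξ) h2
    exact ⟨h.connected, h.neighborSet_ncard, h.arcTransitive, h.girth_eq, card_rightCosets_pslA h2,
      h.action_injective, h.halfArcTransitive, h.ncard_cyclesThrough⟩
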